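/- Let $\mathbb{K}\in\{\mathbb{R},\mathbb{C}\}$, let $m,q,r\geq 0$ be integers, $p\in[1,\infty)$, and let $$\mathcal{B}=\begin{pmatrix}\mathcal{B}^{11}&\mathcal{B}^{12}\\ \mathcal{B}^{21}&\mathcal{B}^{22}\end{pmatrix}$$ be an $(m+q)\times(m+r)$ matrix over $\mathbb{K}$ (for instance a real matrix), with blocks of dimensions $m\times m$, $m\times r$, $q\times m$ and $q\times r$. Let $\boldsymbol{X}_p=L^p(0,1)^m\times L^p(0,\infty)^{q}\times L^p(0,\infty)^{r}$ ($\mathbb{K}$-valued functions), and let $A_p$ be the operator in $\boldsymbol{X}_p$ given by $A_p(\boldsymbol{u},\boldsymbol{v},\boldsymbol{w})=(-\partial_x\boldsymbol{u},-\partial_x\boldsymbol{v},\partial_x\boldsymbol{w})$ on the domain $$D(A_p)=\left\{(\boldsymbol{u},\boldsymbol{v},\boldsymbol{w})\in W^{1,p}(0,1)^m\times W^{1,p}(0,\infty)^{q}\times W^{1,p}(0,\infty)^{r}:\ \begin{pmatrix}\boldsymbol{u}(0)\\ \boldsymbol{v}(0)\end{pmatrix}=\mathcal{B}\begin{pmatrix}\boldsymbol{u}(1)\\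 \boldsymbol{w}(0)\end{pmatrix}\right\}.$$ For $t\geq 0$ and $f=(\mathring{\boldsymbol{u}},\mathring{\boldsymbol{v}},\mathring{\boldsymbol{w}})\in\boldsymbol{X}_p$ put $T(t)f=(\boldsymbol{u}(\cdot,t),\boldsymbol{v}(\cdot,t),\boldsymbol{w}(\cdot,t))$, where, for almost every $x$ in $(0,1)$, respectively $(0,\infty)$, \begin{align*} \boldsymbol{u}(x,t)&=(\mathcal{B}^{11})^n\mathring{\boldsymbol{u}}(n-t+x)+\sum_{k=0}^{n-1}(\mathcal{B}^{11})^k\mathcal{B}^{12}\mathring{\boldsymbol{w}}(t-x-k),\\ \boldsymbol{v}(x,t)&=\mathbf{1}_{\{x>t\}}\mathring{\boldsymbol{v}}(x-t)+\mathbf{1}_{\{x<t\}}\Big(\mathcal{B}^{21}(\mathcal{B}^{11})^n\mathring{\boldsymbol{u}}(n-t+x+1)+\mathcal{B}^{21}\sum_{k=0}^{n-1}(\mathcal{B}^{11})^k\mathcal{B}^{12}\mathring{\boldsymbol{w}}(t-x-k-1)+\mathcal{B}^{22}\mathring{\boldsymbol{w}}(t-x)\Big),\\ \boldsymbol{w}(x,t)&=\mathring{\boldsymbol{w}}(x+t),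 \end{align*} with $n\in\{0,1,2,\dots\}$ determined by $0<n-t+x<1$ in the formula for $\boldsymbol{u}$ and by $0<n-t+x+1<1$ in the formula for $\boldsymbol{v}$. Then this formula defines a (unique) family $T=(T(t))_{t\geq 0}$ of bounded linear operators on $\boldsymbol{X}_p$, and there is $\omega\in\mathbb{R}$ such that for every $\lambda\in\mathbb{K}$ with $\operatorname{Re}\lambda>\omega$ the resolvent $R(\lambda,A_p)=(\lambda I-A_p)^{-1}$ exists as a bounded operator on $\boldsymbol{X}_p$ and equals the Laplace transform of $T$ at $\lambda$: $$R(\lambda,A_p)f=\int_0^\infty e^{-\lambda t}\,T(t)f\,dt\qquad\text{for all } f\in\boldsymbol{X}_p,$$ where the integral converges absolutely in $\boldsymbol{X}_p$, and the same identity holds, with absolutely convergent integrals of the expressions $\boldsymbol{u}(x,t),\boldsymbol{v}(x,t),\boldsymbol{w}(x,t)$ above (formed from fixed measurable representatives of $\mathring{\boldsymbol{u}},\mathring{\boldsymbol{v}},\mathring{\boldsymbol{w}}$), componentwise at almost every $x$. Moreover, $(T(t))_{t\geq 0}$ is a $C_0$-semigroup on $\boldsymbol{X}_p$, and its generator is $(A_p,D(A_p))$.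 -/

import Mathlib

open MeasureTheory Set Filter Topology
open scoped NNReal ENNReal ContDiff Matrix

namespace NetworkTransport

section Semigroups

variable {𝕜 : Type*} [RCLike 𝕜] {X : Type*} [NormedAddCommGroup X] [NormedSpace 𝕜 X]

/-- `T` is a strongly continuous one-parameter semigroup of bounded linear operators. -/
structure IsC0Semigroup (T : ℝ≥0 → X →L[𝕜] X) : Prop where
  map_zero : T 0 = ContinuousLinearMap.id 𝕜 X
  map_add : ∀ s t : ℝ≥0, T (s + t) = (T s).comp (T t)
  strongly_continuous : ∀ f : X, Continuous fun t : ℝ≥0 => T t f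

/-- The (possibly unbounded) operator `A` is the infinitesimal generator of `T`: a vector `f` lies
in the domain of `A`, with `A f = g`, exactly when `(T h f - f) / h → g` in norm as `h → 0+`. -/
def IsGenerator (T : ℝ≥0 → X →L[𝕜] X) (A : X →ₗ.[𝕜] X) : Prop :=
  ∀ f g : X, (f, g) ∈ A.graph ↔
    Tendsto (fun h : ℝ≥0 => (((h : ℝ) : 𝕜))⁻¹ • (T h f - f)) (𝓝[>] 0) (𝓝 g)

/-- `R` is the resolvent operator `(lam I - A)⁻¹`: a bounded everywhere defined operator with
values in the domain of `A` that is a two-sided inverse of `lam I - A`. -/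
structure IsResolvent (A : X →ₗ.[𝕜] X) (lam : 𝕜) (R : X →L[𝕜] X) : Prop where
  mem_domain : ∀ f : X, R f ∈ A.domain
  right_inv : ∀ f : X, lam • R f - A ⟨R f, mem_domain f⟩ = f
  left_inv : ∀ f : A.domain, R (lam • (f : X) - A f) = f

end Semigroups

section Spaces

variable {𝕜 : Type*} [RCLike 𝕜]

/-- Lebesgue measure on the bounded edge `(0,1)`. -/
noncomputable abbrev muB : Measure ℝ := volume.restrict (Ioo (0 : ℝ) 1)

/-- Lebesgue measure on the unbounded edge `(0,∞)`. -/
noncomputable abbrev muU : Measure ℝ := volume.restrict (Ioi (0 : ℝ))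

/-- The space `X_p = L^p(0,1)^m × (L^p(0,∞)^q × L^p(0,∞)^r)` of triples `(u, v, w)`. -/
abbrev StateSpace (𝕜 : Type*) [RCLike 𝕜] (p : ℝ≥0∞) (m q r : ℕ) : Type _ :=
  (Fin m → Lp 𝕜 p muB) × (Fin q → Lp 𝕜 p muU) × (Fin r → Lp 𝕜 p muU)

/-- `g` is the weak derivative of `f` on the open set `s ⊆ ℝ`. -/
def HasWeakDerivOn (s : Set ℝ) (f g : ℝ → 𝕜) : Prop :=
  ∀ φ : ℝ → ℝ, ContDiff ℝ ∞ φ → HasCompactSupport φ → tsupport φ ⊆ s →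
    ∫ x in s, deriv φ x • f x = -∫ x in s, φ x • g x

/-- The class of `f` on `s` has a representative `F` that is continuous on the closure of `s`,
and the value of `F` at the point `a` is `c`. (Elements of `W^{1,p}` of an open interval always
have exactly one such `F` on the closed interval; this is how their boundary values are read.) -/
def HasBoundaryValue (s : Set ℝ) (f : ℝ → 𝕜) (a : ℝ) (c : 𝕜) : Prop :=
  ∃ F : ℝ → 𝕜, ContinuousOn F (closure s) ∧ f =ᵐ[volume.restrict s] F ∧ F a = c

end Spaces

section Operator

variable {𝕜 : Type*} [RCLike 𝕜] {p : ℝ≥0∞} {m q r : ℕ}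

/-- `f = (u, v, w)` and `g` in `X_p` satisfy `g = (-u', -v', w')` with weak derivatives (so that
all components of `f` are in `W^{1,p}`) and `(u(0), v(0)) = B (u(1), w(0))`. -/
structure IsTransportPair (B : Matrix (Fin m ⊕ Fin q) (Fin m ⊕ Fin r) 𝕜)
    (f g : StateSpace 𝕜 p m q r) : Prop where
  deriv_u : ∀ j, HasWeakDerivOn (Ioo (0 : ℝ) 1) (f.1 j) (-(g.1 j) : Lp 𝕜 p muB)
  deriv_v : ∀ j, HasWeakDerivOn (Ioi (0 : ℝ)) (f.2.1 j) (-(g.2.1 j) : Lp 𝕜 p muU)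
  deriv_w : ∀ j, HasWeakDerivOn (Ioi (0 : ℝ)) (f.2.2 j) (g.2.2 j)
  boundary : ∃ (u0 u1 : Fin m → 𝕜) (v0 : Fin q → 𝕜) (w0 : Fin r → 𝕜),
    (∀ j, HasBoundaryValue (Ioo (0 : ℝ) 1) (f.1 j) 0 (u0 j)) ∧
    (∀ j, HasBoundaryValue (Ioo (0 : ℝ) 1) (f.1 j) 1 (u1 j)) ∧
    (∀ j, HasBoundaryValue (Ioi (0 : ℝ)) (f.2.1 j) 0 (v0 j)) ∧
    (∀ j, HasBoundaryValue (Ioi (0 : ℝ)) (f.2.2 j) 0 (w0 j)) ∧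
    Sum.elim u0 v0 = B *ᵥ Sum.elim u1 w0

lemma integrable_smul_Lp [Fact (1 ≤ p)] {s : Set ℝ} (f : Lp 𝕜 p (volume.restrict s)) {φ : ℝ → ℝ}
    (hφ : Continuous φ) (hc : HasCompactSupport φ) :
    IntegrableOn (fun x => φ x • f x) s :=
  ((Lp.memLp f).locallyIntegrable Fact.out).integrable_smul_left_of_hasCompactSupport hφ hc

lemma HasWeakDerivOn.congr {s : Set ℝ} {f g f' g' : ℝ → 𝕜}
    (h : HasWeakDerivOn s f g) (hf : f =ᵐ[volume.restrict s] f')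
    (hg : g =ᵐ[volume.restrict s] g') : HasWeakDerivOn s f' g' := by
  intro φ h1 h2 h3
  have e1 : ∫ x in s, deriv φ x • f x = ∫ x in s, deriv φ x • f' x :=
    integral_congr_ae (hf.mono fun x hx => by simp only [hx])
  have e2 : ∫ x in s, φ x • g x = ∫ x in s, φ x • g' x :=
    integral_congr_ae (hg.mono fun x hx => by simp only [hx])
  rw [← e1, ← e2]
  exact h φ h1 h2 h3

lemma HasWeakDerivOn.add [Fact (1 ≤ p)] {s : Set ℝ} {f g f' g' : Lp 𝕜 p (volume.restrict s)}
    (h : HasWeakDerivOn s f g) (h' : HasWeakDerivOn s f' g') :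
    HasWeakDerivOn s (f + f' : Lp 𝕜 p (volume.restrict s))
      (g + g' : Lp 𝕜 p (volume.restrict s)) := by
  have key : HasWeakDerivOn s (fun x => f x + f' x) (fun x => g x + g' x) := by
    intro φ h1 h2 h3
    have hd : Continuous (deriv φ) := h1.continuous_deriv (by simp)
    simp only [smul_add]
    rw [integral_add (integrable_smul_Lp f hd h2.deriv) (integrable_smul_Lp f' hd h2.deriv),
      integral_add (integrable_smul_Lp g h1.continuous h2) (integrable_smul_Lp g' h1.continuous h2),
      h φ h1 h2 h3, h' φ h1 h2 h3, neg_add]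
  exact key.congr (Lp.coeFn_add f f').symm (Lp.coeFn_add g g').symm

lemma HasWeakDerivOn.const_smul {s : Set ℝ} (c : 𝕜) {f g : Lp 𝕜 p (volume.restrict s)}
    (h : HasWeakDerivOn s f g) :
    HasWeakDerivOn s (c • f : Lp 𝕜 p (volume.restrict s))
      (c • g : Lp 𝕜 p (volume.restrict s)) := by
  have key : HasWeakDerivOn s (fun x => c • f x) (fun x => c • g x) := by
    intro φ h1 h2 h3
    simp only [smul_comm _ c]
    rw [integral_smul, integral_smul, h φ h1 h2 h3, smul_neg]
  exact key.congr (Lp.coeFn_smul c f).symm (Lp.coeFn_smul c g).symm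

lemma HasWeakDerivOn.zero {s : Set ℝ} : HasWeakDerivOn s (0 : Lp 𝕜 p (volume.restrict s))
    (0 : Lp 𝕜 p (volume.restrict s)) := by
  have key : HasWeakDerivOn s (0 : ℝ → 𝕜) (0 : ℝ → 𝕜) := by
    intro φ h1 h2 h3
    simp
  exact key.congr (Lp.coeFn_zero _ _ _).symm (Lp.coeFn_zero _ _ _).symm

/-- The weak derivative on an open set is unique. -/
lemma HasWeakDerivOn.eq_zero [Fact (1 ≤ p)] {s : Set ℝ} (hs : IsOpen s)
    {g : Lp 𝕜 p (volume.restrict s)}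
    (h : HasWeakDerivOn s (0 : Lp 𝕜 p (volume.restrict s)) g) : g = 0 := by
  have h0 : HasWeakDerivOn s (0 : ℝ → 𝕜) g := h.congr (Lp.coeFn_zero _ _ _) (ae_eq_refl _)
  have hloc : LocallyIntegrable g (volume.restrict s) :=
    (Lp.memLp g).locallyIntegrable Fact.out
  have := hs.ae_eq_zero_of_integral_contDiff_smul_eq_zero
    (μ := volume.restrict s) (hloc.locallyIntegrableOn s) (fun φ h1 h2 h3 => by
      have := h0 φ h1 h2 h3
      simpa using this)
  rw [Lp.eq_zero_iff_ae_eq_zero]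
  filter_upwards [this, ae_restrict_mem hs.measurableSet] with x hx hxs
  exact hx hxs

lemma HasBoundaryValue.add {s : Set ℝ} {a : ℝ} {c c' : 𝕜} {f f' : Lp 𝕜 p (volume.restrict s)}
    (h : HasBoundaryValue s f a c) (h' : HasBoundaryValue s f' a c') :
    HasBoundaryValue s (f + f' : Lp 𝕜 p (volume.restrict s)) a (c + c') := by
  obtain ⟨F, h1, h2, h3⟩ := h
  obtain ⟨F', h1', h2', h3'⟩ := h'
  exact ⟨F + F', h1.add h1', (Lp.coeFn_add f f').trans (h2.add h2'), by simp [h3, h3']⟩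

lemma HasBoundaryValue.const_smul {s : Set ℝ} {a : ℝ} {c : 𝕜} (k : 𝕜)
    {f : Lp 𝕜 p (volume.restrict s)} (h : HasBoundaryValue s f a c) :
    HasBoundaryValue s (k • f : Lp 𝕜 p (volume.restrict s)) a (k • c) := by
  obtain ⟨F, h1, h2, h3⟩ := h
  exact ⟨k • F, h1.const_smul k, (Lp.coeFn_smul k f).trans (h2.const_smul k), by simp [h3]⟩

lemma HasBoundaryValue.zero {s : Set ℝ} {a : ℝ} :
    HasBoundaryValue s (0 : Lp 𝕜 p (volume.restrict s)) a 0 :=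
  ⟨0, continuousOn_const, Lp.coeFn_zero _ _ _, rfl⟩

/-- The graph of the transport operator. -/
def transportGraph [Fact (1 ≤ p)] (B : Matrix (Fin m ⊕ Fin q) (Fin m ⊕ Fin r) 𝕜) :
    Submodule 𝕜 (StateSpace 𝕜 p m q r × StateSpace 𝕜 p m q r) where
  carrier := {x | IsTransportPair B x.1 x.2}
  zero_mem' := by
    refine ⟨fun j => ?_, fun j => ?_, fun j => ?_, 0, 0, 0, 0, fun j => ?_, fun j => ?_,
      fun j => ?_, fun j => ?_, ?_⟩
    · simpa using HasWeakDerivOn.zero (p := p) (𝕜 := 𝕜)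
    · simpa using HasWeakDerivOn.zero (p := p) (𝕜 := 𝕜)
    · exact HasWeakDerivOn.zero
    · exact HasBoundaryValue.zero
    · exact HasBoundaryValue.zero
    · exact HasBoundaryValue.zero
    · exact HasBoundaryValue.zero
    · have h1 : (Sum.elim 0 0 : Fin m ⊕ Fin q → 𝕜) = 0 := by ext (i | i) <;> rfl
      have h2 : (Sum.elim 0 0 : Fin m ⊕ Fin r → 𝕜) = 0 := by ext (i | i) <;> rfl
      rw [h1, h2, Matrix.mulVec_zero]
  add_mem' := by
    rintro x y ⟨xu, xv, xw, u0, u1, v0, w0, hu0, hu1, hv0, hw0, hB⟩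
      ⟨yu, yv, yw, u0', u1', v0', w0', hu0', hu1', hv0', hw0', hB'⟩
    refine ⟨fun j => ?_, fun j => ?_, fun j => ?_, u0 + u0', u1 + u1', v0 + v0', w0 + w0',
      fun j => (hu0 j).add (hu0' j), fun j => (hu1 j).add (hu1' j),
      fun j => (hv0 j).add (hv0' j), fun j => (hw0 j).add (hw0' j), ?_⟩
    · have := (xu j).add (yu j)
      rwa [← neg_add] at this
    · have := (xv j).add (yv j)
      rwa [← neg_add] at this
    · exact (xw j).add (yw j)
    · have h1 : (Sum.elim (u0 + u0') (v0 + v0') : Fin m ⊕ Fin q → 𝕜)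
          = Sum.elim u0 v0 + Sum.elim u0' v0' := by ext (i | i) <;> rfl
      have h2 : (Sum.elim (u1 + u1') (w0 + w0') : Fin m ⊕ Fin r → 𝕜)
          = Sum.elim u1 w0 + Sum.elim u1' w0' := by ext (i | i) <;> rfl
      rw [h1, h2, Matrix.mulVec_add, hB, hB']
  smul_mem' := by
    rintro c x ⟨xu, xv, xw, u0, u1, v0, w0, hu0, hu1, hv0, hw0, hB⟩
    refine ⟨fun j => ?_, fun j => ?_, fun j => ?_, c • u0, c • u1, c • v0, c • w0,
      fun j => (hu0 j).const_smul c, fun j => (hu1 j).const_smul c,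
      fun j => (hv0 j).const_smul c, fun j => (hw0 j).const_smul c, ?_⟩
    · have := (xu j).const_smul c
      rwa [smul_neg] at this
    · have := (xv j).const_smul c
      rwa [smul_neg] at this
    · exact (xw j).const_smul c
    · have h1 : (Sum.elim (c • u0) (c • v0) : Fin m ⊕ Fin q → 𝕜)
          = c • Sum.elim u0 v0 := by ext (i | i) <;> rfl
      have h2 : (Sum.elim (c • u1) (c • w0) : Fin m ⊕ Fin r → 𝕜)
          = c • Sum.elim u1 w0 := by ext (i | i) <;> rfl
      rw [h1, h2, Matrix.mulVec_smul, hB]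

/-- The transport operator `A_p = diag(-∂ₓ, …, -∂ₓ, ∂ₓ, …, ∂ₓ)`, whose domain consists of the
`(u, v, w)` with all components in `W^{1,p}` and `(u(0), v(0)) = B (u(1), w(0))`. -/
noncomputable def transportOperator (p : ℝ≥0∞) [Fact (1 ≤ p)]
    (B : Matrix (Fin m ⊕ Fin q) (Fin m ⊕ Fin r) 𝕜) :
    StateSpace 𝕜 p m q r →ₗ.[𝕜] StateSpace 𝕜 p m q r :=
  (transportGraph B).toLinearPMap

/-- The operator is well defined: its graph is exactly the set of transport pairs. -/
lemma mem_graph_transportOperator [Fact (1 ≤ p)]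
    (B : Matrix (Fin m ⊕ Fin q) (Fin m ⊕ Fin r) 𝕜) (f g : StateSpace 𝕜 p m q r) :
    (f, g) ∈ (transportOperator p B).graph ↔ IsTransportPair B f g := by
  have hg : ∀ x : StateSpace 𝕜 p m q r × StateSpace 𝕜 p m q r,
      x ∈ transportGraph B → x.1 = 0 → x.2 = 0 := by
    rintro ⟨f, g⟩ h h0
    obtain rfl : f = 0 := h0
    refine Prod.ext (funext fun j => ?_) (Prod.ext (funext fun j => ?_) (funext fun j => ?_))
    · exact neg_eq_zero.1 (HasWeakDerivOn.eq_zero isOpen_Ioo (h.deriv_u j))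
    · exact neg_eq_zero.1 (HasWeakDerivOn.eq_zero isOpen_Ioi (h.deriv_v j))
    · exact HasWeakDerivOn.eq_zero isOpen_Ioi (h.deriv_w j)
  rw [transportOperator, Submodule.toLinearPMap_graph_eq _ hg]
  rfl

end Operator

section Formula

variable {𝕜 : Type*} [RCLike 𝕜] {p : ℝ≥0∞} {m q r : ℕ}

/-- The number `n` used in the formula for `u(x,t)`: see `uIndex_iff`. -/
noncomputable def uIndex (t x : ℝ) : ℕ := ⌈t - x⌉₊

/-- The number `n` used in the formula for `v(x,t)`: see `vIndex_iff`. -/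
noncomputable def vIndex (t x : ℝ) : ℕ := ⌊t - x⌋₊

/-- For `x < 1`, `t ≥ 0` and `t - x ∉ ℤ`, the only `n ∈ ℕ` with `0 < n - t + x < 1` is `uIndex`. -/
lemma uIndex_iff {t x : ℝ} (ht : 0 ≤ t) (hx : x < 1) (hZ : ∀ z : ℤ, t - x ≠ z) (n : ℕ) :
    (0 < n - t + x ∧ n - t + x < 1) ↔ n = uIndex t x := by
  unfold uIndex
  have hne : t - x ≠ (n : ℝ) := by simpa using hZ n
  constructor
  · rintro ⟨h1, h2⟩
    rcases n.eq_zero_or_pos with rfl | hn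
    · symm
      rw [Nat.ceil_eq_zero]
      push_cast at h1
      linarith
    · symm
      rw [Nat.ceil_eq_iff hn.ne', Nat.cast_sub hn]
      push_cast
      constructor <;> linarith
  · intro h
    have h1 : t - x ≤ n := by rw [h]; exact Nat.le_ceil _
    refine ⟨by linarith [lt_of_le_of_ne h1 hne], ?_⟩
    rcases n.eq_zero_or_pos with rfl | hn
    · push_cast
      linarith
    · have := (Nat.ceil_eq_iff hn.ne').1 h.symm
      have h3 := this.1
      rw [Nat.cast_sub hn] at h3
      push_cast at h3
      linarith

/-- For `x < t` and `t - x ∉ ℤ`, the only `n ∈ ℕ` with `0 < n - t + x + 1 < 1` is `vIndex`. -/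
lemma vIndex_iff {t x : ℝ} (hx : x < t) (hZ : ∀ z : ℤ, t - x ≠ z) (n : ℕ) :
    (0 < n - t + x + 1 ∧ n - t + x + 1 < 1) ↔ n = vIndex t x := by
  unfold vIndex
  have hne : t - x ≠ (n : ℝ) := by simpa using hZ n
  rw [eq_comm, Nat.floor_eq_iff (by linarith)]
  constructor
  · rintro ⟨h1, h2⟩
    constructor <;> linarith
  · rintro ⟨h1, h2⟩
    exact ⟨by linarith, by linarith [lt_of_le_of_ne h1 hne.symm]⟩

/-- The first component
`u(x,t) = (B¹¹)ⁿ u₀(n-t+x) + ∑_{k<n} (B¹¹)ᵏ B¹² w₀(t-x-k)`, where `0 < n-t+x < 1`. -/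
noncomputable def solU (B : Matrix (Fin m ⊕ Fin q) (Fin m ⊕ Fin r) 𝕜)
    (u₀ : ℝ → Fin m → 𝕜) (w₀ : ℝ → Fin r → 𝕜) (t x : ℝ) : Fin m → 𝕜 :=
  let n := uIndex t x
  (B.toBlocks₁₁ ^ n) *ᵥ u₀ (n - t + x) +
    ∑ k ∈ Finset.range n, (B.toBlocks₁₁ ^ k * B.toBlocks₁₂) *ᵥ w₀ (t - x - k)

/-- The second component: `v(x,t) = v₀(x-t)` for `x > t`, and
`v(x,t) = B²¹ (B¹¹)ⁿ u₀(n-t+x+1) + B²¹ ∑_{k<n} (B¹¹)ᵏ B¹² w₀(t-x-k-1) + B²² w₀(t-x)`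
for `x < t`, where `0 < n-t+x+1 < 1`. -/
noncomputable def solV (B : Matrix (Fin m ⊕ Fin q) (Fin m ⊕ Fin r) 𝕜)
    (u₀ : ℝ → Fin m → 𝕜) (v₀ : ℝ → Fin q → 𝕜) (w₀ : ℝ → Fin r → 𝕜) (t x : ℝ) : Fin q → 𝕜 :=
  if t < x then v₀ (x - t)
  else if x < t then
    let n := vIndex t x
    (B.toBlocks₂₁ * B.toBlocks₁₁ ^ n) *ᵥ u₀ (n - t + x + 1) +
      B.toBlocks₂₁ *ᵥ (∑ k ∈ Finset.range n,
        (B.toBlocks₁₁ ^ k * B.toBlocks₁₂) *ᵥ w₀ (t - x - k - 1)) +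
      B.toBlocks₂₂ *ᵥ w₀ (t - x)
  else 0

/-- The third component `w(x,t) = w₀(x+t)`. -/
def solW (w₀ : ℝ → Fin r → 𝕜) (t x : ℝ) : Fin r → 𝕜 := w₀ (x + t)

/-- The components of `f ∈ X_p` as vector-valued functions. -/
noncomputable def uFun (f : StateSpace 𝕜 p m q r) (x : ℝ) : Fin m → 𝕜 := fun j => f.1 j x
noncomputable def vFun (f : StateSpace 𝕜 p m q r) (x : ℝ) : Fin q → 𝕜 := fun j => f.2.1 j x
noncomputable def wFun (f : StateSpace 𝕜 p m q r) (x : ℝ) : Fin r → 𝕜 := fun j => f.2.2 j x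

/-- The explicit formula with initial data `f ∈ X_p`, as a triple of functions of `x`. -/
noncomputable def formulaU (B : Matrix (Fin m ⊕ Fin q) (Fin m ⊕ Fin r) 𝕜)
    (f : StateSpace 𝕜 p m q r) (t x : ℝ) : Fin m → 𝕜 := solU B (uFun f) (wFun f) t x
noncomputable def formulaV (B : Matrix (Fin m ⊕ Fin q) (Fin m ⊕ Fin r) 𝕜)
    (f : StateSpace 𝕜 p m q r) (t x : ℝ) : Fin q → 𝕜 := solV B (uFun f) (vFun f) (wFun f) t x
noncomputable def formulaW (f : StateSpace 𝕜 p m q r) (t x : ℝ) : Fin r → 𝕜 :=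
  solW (wFun f) t x

/-- `T` is the family of operators on `X_p` given by the explicit formula. -/
def IsExplicitFamily [Fact (1 ≤ p)] (B : Matrix (Fin m ⊕ Fin q) (Fin m ⊕ Fin r) 𝕜)
    (T : ℝ≥0 → StateSpace 𝕜 p m q r →L[𝕜] StateSpace 𝕜 p m q r) : Prop :=
  ∀ (t : ℝ≥0) (f : StateSpace 𝕜 p m q r),
    (∀ j, (T t f).1 j =ᵐ[muB] fun x => formulaU B f t x j) ∧
    (∀ j, (T t f).2.1 j =ᵐ[muU] fun x => formulaV B f t x j) ∧
    (∀ j, (T t f).2.2 j =ᵐ[muU] fun x => formulaW f t x j)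

/-- The exponential weight `e^{-lam t}`. -/
noncomputable def expWeight (lam : 𝕜) (t : ℝ) : 𝕜 := NormedSpace.exp (-(lam * (t : 𝕜)))

/-- The function `y` on `(0,∞)` has an absolutely convergent Laplace transform at `lam`, equal to `c`. -/
def HasLaplace {E : Type*} [NormedAddCommGroup E] [NormedSpace 𝕜 E] [NormedSpace ℝ E]
    (lam : 𝕜) (y : ℝ → E) (c : E) : Prop :=
  IntegrableOn (fun t => expWeight lam t • y t) (Ioi 0) ∧
    ∫ t in Ioi (0 : ℝ), expWeight lam t • y t = c

end Formula

end NetworkTransport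

/-!
The solution formula is a statement about translations. The datum `u` on the bounded edges is
continued to the left of `0` by the recursion `U y = B¹¹ U(y + 1) + B¹² w(-y)`, which is the boundary
condition read along characteristics, and the datum `v` by `V y = B²¹ U(y + 1) + B²² w(-y)`. Then
`u(x, t) = U(x - t)`, `v(x, t) = V(x - t)` and `w(x, t) = w(x + t)` (`solU_eq_extU`,
`solV_eq_extV`).

*Semigroup.* The extended datum of the solution at time `t` is the translate by `t` of the extended
datum (`IsSolutionAt.stateU_eq`, `IsSolutionAt.stateV_eq`), so that solution operators compose, and
uniqueness gives the semigroup law. For `t ≤ 1` the solution operator `stepOp` is a finite matrix of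
translations and reflections between the edges; hence it is bounded, and strongly continuous since
translations are so in `L^p(ℝ)` for `p < ∞`. Composition provides the operators for all `t`, and a
bound on `[0, 1]`, from the uniform boundedness principle, provides exponential growth.

*Laplace transform.* For a strongly continuous semigroup `T` with `‖T t‖ ≤ M e^{bt}`, the Laplace
transform at `lam` with `re lam > b` inverts `lam` minus the generator
(`IsC0Semigroup.isRightDeriv_laplace`, `IsC0Semigroup.laplace_sub_eq`). A Bochner integral in `L^p`
of a jointly measurable family is computed pointwise almost everywhere, by Fubini's theorem
(`ae_integral_Lp_eq`), which gives the componentwise identities.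

*Generator.* Let `l` be real and large. The pointwise formula exhibits the components of the Laplace
transform of an orbit as `e^{-lx} ∫_{-∞}^x e^{ls} U(s) ds` and the like. They are exponentials times
primitives, and the recursion for `U` and `V` turns into the boundary condition, so that the
generator is a restriction of the transport operator `A`
(`IsExplicitFamily.isTransportPair_laplace`). Moreover `l - A` is injective
(`IsTransportPair.eq_zero`): by the lemma of du Bois-Reymond an eigenfunction is an exponential,
which vanishes on the edges where it grows, and the boundary condition leaves `c = e^{-l} B¹¹ c`.
As `l` minus the generator is surjective, the two operators are equal
(`IsExplicitFamily.isGenerator`).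
-/

namespace NetworkTransport

/-! ### The exponential weight -/

section ExpWeight

variable {𝕜 : Type*} [RCLike 𝕜]

lemma expWeight_eq_exp_smul (lam : 𝕜) (t : ℝ) :
    expWeight lam t = NormedSpace.exp (t • (-lam)) := by
  rw [expWeight, RCLike.real_smul_eq_coe_mul, mul_neg, mul_comm]

@[simp]
lemma expWeight_zero (lam : 𝕜) : expWeight lam 0 = 1 := by
  simp [expWeight]

lemma expWeight_add (lam : 𝕜) (s t : ℝ) :
    expWeight lam (s + t) = expWeight lam s * expWeight lam t := by
  let _ : NormedAlgebra ℚ 𝕜 := .restrictScalars ℚ ℝ 𝕜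
  rw [expWeight, expWeight, expWeight, ← NormedSpace.exp_add]
  congr 1
  push_cast
  ring

lemma expWeight_ofReal (l t : ℝ) : expWeight (l : 𝕜) t = (Real.exp (-(l * t)) : 𝕜) := by
  rw [expWeight, Real.exp_eq_exp_ℝ, ← RCLike.algebraMap_eq_ofReal,
    NormedSpace.algebraMap_exp_comm]
  simp

lemma norm_expWeight (lam : 𝕜) (t : ℝ) :
    ‖expWeight lam t‖ = Real.exp (-(RCLike.re lam * t)) := by
  let _ : NormedAlgebra ℚ 𝕜 := .restrictScalars ℚ ℝ 𝕜
  have h : ((‖expWeight lam t‖ ^ 2 : ℝ) : 𝕜) = (Real.exp (-(2 * RCLike.re lam * t)) : 𝕜) := by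
    rw [← expWeight_ofReal, RCLike.ofReal_pow, ← RCLike.mul_conj, starRingEnd_apply, expWeight,
      NormedSpace.star_exp, ← NormedSpace.exp_add, expWeight]
    congr 1
    have := RCLike.add_conj lam
    rw [starRingEnd_apply] at this
    simp only [star_neg, star_mul', RCLike.star_def, RCLike.conj_ofReal]
    push_cast
    rw [starRingEnd_apply] at *
    linear_combination (-(t : 𝕜)) * this
  have h' := RCLike.ofReal_injective h
  have h2 : Real.exp (-(2 * RCLike.re lam * t)) = Real.exp (-(RCLike.re lam * t)) ^ 2 := by
    rw [← Real.exp_nat_mul]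
    congr 1
    push_cast
    ring
  rw [h2] at h'
  exact (sq_eq_sq₀ (norm_nonneg _) (Real.exp_pos _).le).1 h'

lemma hasDerivAt_expWeight (lam : 𝕜) (t : ℝ) :
    HasDerivAt (expWeight lam) (expWeight lam t * (-lam)) t := by
  have h := hasDerivAt_exp_smul_const (𝕂 := ℝ) (-lam) t
  rw [expWeight_eq_exp_smul]
  exact h.congr_of_eventuallyEq (Eventually.of_forall fun s => expWeight_eq_exp_smul lam s)

lemma continuous_expWeight (lam : 𝕜) : Continuous (expWeight lam) :=
  continuous_iff_continuousAt.2 fun t => (hasDerivAt_expWeight lam t).continuousAt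

end ExpWeight

/-! ### Semigroups and their Laplace transforms -/

section Abstract

variable {𝕜 : Type*} [RCLike 𝕜] {X : Type*} [NormedAddCommGroup X] [NormedSpace 𝕜 X]

/-- A semigroup that is bounded on `[0, 1]` grows at most exponentially. -/
lemma exists_exp_bound {T : ℝ≥0 → X →L[𝕜] X} (h0 : T 0 = ContinuousLinearMap.id 𝕜 X)
    (hadd : ∀ s t : ℝ≥0, T (s + t) = (T s).comp (T t)) {K : ℝ}
    (hK : ∀ t : ℝ≥0, t ≤ 1 → ‖T t‖ ≤ K) :
    ∃ M b : ℝ, 0 ≤ M ∧ ∀ t : ℝ≥0, ‖T t‖ ≤ M * Real.exp (b * t) := by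
  set C := max K 1
  have hC1 : 1 ≤ C := le_max_right _ _
  have hC : ∀ t : ℝ≥0, t ≤ 1 → ‖T t‖ ≤ C := fun t ht => (hK t ht).trans (le_max_left _ _)
  have key : ∀ n : ℕ, ∀ t : ℝ≥0, t ≤ n → ‖T t‖ ≤ C ^ n := by
    intro n
    induction n with
    | zero =>
      intro t ht
      have : t = 0 := by simpa using ht
      rw [this, h0, pow_zero]
      exact ContinuousLinearMap.norm_id_le
    | succ n ih =>
      intro t ht
      rcases le_total t 1 with h1 | h1
      · exact (hC t h1).trans (le_self_pow₀ hC1 (Nat.succ_ne_zero n))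
      · have e : t = (t - 1) + 1 := (tsub_add_cancel_of_le h1).symm
        rw [e, hadd, pow_succ]
        refine (ContinuousLinearMap.opNorm_comp_le _ _).trans ?_
        have : t - 1 ≤ n := by
          rw [tsub_le_iff_right]
          exact_mod_cast ht
        gcongr
        · exact ih _ this
        · exact hC 1 le_rfl
  refine ⟨C, Real.log C, by positivity, fun t => ?_⟩
  refine (key ⌈t⌉₊ t (Nat.le_ceil t)).trans ?_
  have hpos : 0 < C := by positivity
  calc C ^ ⌈t⌉₊ = C ^ (⌈t⌉₊ : ℝ) := (Real.rpow_natCast _ _).symm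
    _ ≤ C ^ ((1 : ℝ) + t) := by
      refine Real.rpow_le_rpow_of_exponent_le hC1 ?_
      have : ((⌈t⌉₊ : ℝ≥0) : ℝ) < ((t + 1 : ℝ≥0) : ℝ) :=
        NNReal.coe_lt_coe.2 (Nat.ceil_lt_add_one zero_le)
      push_cast at this
      linarith
    _ = C * Real.exp (Real.log C * t) := by
      rw [Real.rpow_add hpos, Real.rpow_one, Real.rpow_def_of_pos hpos]

/-- For a semigroup that is bounded on compact time intervals, right continuity of the orbits at
`0` implies strong continuity. -/
lemma IsC0Semigroup.of_tendsto_zero {T : ℝ≥0 → X →L[𝕜] X}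
    (h0 : T 0 = ContinuousLinearMap.id 𝕜 X)
    (hadd : ∀ s t : ℝ≥0, T (s + t) = (T s).comp (T t)) {M b : ℝ} (hM0 : 0 ≤ M)
    (hM : ∀ t : ℝ≥0, ‖T t‖ ≤ M * Real.exp (b * t))
    (hT : ∀ f : X, Tendsto (fun t => T t f) (𝓝 0) (𝓝 f)) : IsC0Semigroup T := by
  refine ⟨h0, hadd, fun f => continuous_iff_continuousAt.2 fun t₀ => ?_⟩
  have hle : ∀ s t : ℝ≥0, ‖T t f - T s f‖ ≤
      M * Real.exp (|b| * (t + s)) * ‖T (nndist t s) f - f‖ := by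
    have key : ∀ s t : ℝ≥0, s ≤ t → ‖T t f - T s f‖ ≤
        M * Real.exp (|b| * (t + s)) * ‖T (nndist t s) f - f‖ := by
      intro s t hst
      have e : t = s + nndist t s := by
        rw [← NNReal.coe_inj, NNReal.coe_add, coe_nndist, NNReal.dist_eq,
          abs_of_nonneg (sub_nonneg.2 (NNReal.coe_le_coe.2 hst))]
        ring
      have e2 : T t f - T s f = T s (T (nndist t s) f - f) := by
        conv_lhs => rw [e, hadd]
        simp
      rw [e2]
      refine ((T s).le_opNorm _).trans ?_
      refine mul_le_mul_of_nonneg_right ((hM s).trans ?_) (norm_nonneg _)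
      gcongr
      · exact le_abs_self b
      · exact le_add_of_nonneg_left t.2
    intro s t
    rcases le_total s t with h | h
    · exact key s t h
    · rw [norm_sub_rev, nndist_comm, add_comm (t : ℝ)]
      exact key t s h
  rw [ContinuousAt, tendsto_iff_norm_sub_tendsto_zero]
  refine squeeze_zero (fun _ => norm_nonneg _) (fun t => hle t₀ t) ?_
  have h1 : Tendsto (fun t : ℝ≥0 => nndist t t₀) (𝓝 t₀) (𝓝 0) := by
    have : Continuous fun t : ℝ≥0 => nndist t t₀ := by fun_prop
    simpa using this.tendsto t₀
  have h2 : Tendsto (fun t : ℝ≥0 => ‖T (nndist t t₀) f - f‖) (𝓝 t₀) (𝓝 0) :=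
    tendsto_iff_norm_sub_tendsto_zero.1 ((hT f).comp h1)
  have h3 : Tendsto (fun t : ℝ≥0 => M * Real.exp (|b| * (t + t₀))) (𝓝 t₀)
      (𝓝 (M * Real.exp (|b| * (t₀ + t₀)))) := by
    have : Continuous fun t : ℝ≥0 => M * Real.exp (|b| * (t + t₀)) := by fun_prop
    exact this.tendsto t₀
  simpa using h3.mul h2

lemma IsC0Semigroup.continuous_weighted {T : ℝ≥0 → X →L[𝕜] X} (hT : IsC0Semigroup T)
    (lam : 𝕜) (f : X) : Continuous fun t : ℝ => expWeight lam t • T t.toNNReal f :=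
  (continuous_expWeight lam).smul ((hT.strongly_continuous f).comp continuous_real_toNNReal)

lemma norm_weighted_le {T : ℝ≥0 → X →L[𝕜] X} {M b : ℝ}
    (hM : ∀ t : ℝ≥0, ‖T t‖ ≤ M * Real.exp (b * t)) (lam : 𝕜) (f : X) {t : ℝ} (ht : 0 ≤ t) :
    ‖expWeight lam t • T t.toNNReal f‖ ≤
      M * ‖f‖ * Real.exp (-(RCLike.re lam - b) * t) := by
  rw [norm_smul, norm_expWeight]
  have h1 := ((T t.toNNReal).le_opNorm f).trans
    (mul_le_mul_of_nonneg_right (hM t.toNNReal) (norm_nonneg f))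
  rw [Real.coe_toNNReal t ht] at h1
  refine (mul_le_mul_of_nonneg_left h1 (Real.exp_pos _).le).trans_eq ?_
  have : Real.exp (-(RCLike.re lam - b) * t)
      = Real.exp (-(RCLike.re lam * t)) * Real.exp (b * t) := by
    rw [← Real.exp_add]
    congr 1
    ring
  rw [this]
  ring

lemma IsC0Semigroup.integrableOn_weighted {T : ℝ≥0 → X →L[𝕜] X} (hT : IsC0Semigroup T)
    {M b : ℝ} (hM : ∀ t : ℝ≥0, ‖T t‖ ≤ M * Real.exp (b * t)) {lam : 𝕜}
    (hlam : b < RCLike.re lam) (f : X) :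
    IntegrableOn (fun t : ℝ => expWeight lam t • T t.toNNReal f) (Ioi 0) := by
  have hint : IntegrableOn (fun t : ℝ => M * ‖f‖ * Real.exp (-(RCLike.re lam - b) * t)) (Ioi 0) :=
    (exp_neg_integrableOn_Ioi 0 (sub_pos.2 hlam)).const_mul _
  refine hint.mono' ?_ ?_
  · have := (hT.continuous_weighted lam f).stronglyMeasurable
    exact this.aestronglyMeasurable
  · filter_upwards [ae_restrict_mem measurableSet_Ioi] with t ht
    exact norm_weighted_le hM lam f (le_of_lt ht)

variable [NormedSpace ℝ X]

/-- The Laplace transform of a strongly continuous semigroup is a bounded operator. -/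
lemma IsC0Semigroup.exists_laplace [IsScalarTower ℝ 𝕜 X] {T : ℝ≥0 → X →L[𝕜] X}
    (hT : IsC0Semigroup T)
    {M b : ℝ} (hM : ∀ t : ℝ≥0, ‖T t‖ ≤ M * Real.exp (b * t)) {lam : 𝕜}
    (hlam : b < RCLike.re lam) :
    ∃ R : X →L[𝕜] X, ∀ f, HasLaplace lam (fun t : ℝ => T t.toNNReal f) (R f) := by
  have : SMulCommClass ℝ 𝕜 X := IsScalarTower.to_smulCommClass
  have hint := fun f => hT.integrableOn_weighted hM hlam f
  let R₀ : X →ₗ[𝕜] X :=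
    { toFun := fun f => ∫ t in Ioi (0 : ℝ), expWeight lam t • T t.toNNReal f
      map_add' := fun f g => by
        simp only [_root_.map_add, smul_add]
        exact integral_add (hint f) (hint g)
      map_smul' := fun c f => by
        rw [RingHom.id_apply, ← integral_smul]
        refine integral_congr_ae (Eventually.of_forall fun t => ?_)
        change expWeight lam t • T t.toNNReal (c • f) = c • expWeight lam t • T t.toNNReal f
        rw [map_smul, smul_comm] }
  refine ⟨R₀.mkContinuous
    (∫ t in Ioi (0 : ℝ), M * Real.exp (-(RCLike.re lam - b) * t)) fun f => ?_,
    fun f => ⟨hint f, rfl⟩⟩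
  rw [← integral_mul_const]
  refine norm_integral_le_of_norm_le (((exp_neg_integrableOn_Ioi 0
    (sub_pos.2 hlam)).const_mul M).mul_const _) ?_
  filter_upwards [ae_restrict_mem measurableSet_Ioi] with t ht
  refine (norm_weighted_le hM lam f (le_of_lt ht)).trans_eq (by ring)

/-- The relation defining the generator of `T`: the difference quotients of the orbit of `f`
converge to `g` at time `0`. -/
def IsRightDeriv (T : ℝ≥0 → X →L[𝕜] X) (f g : X) : Prop :=
  Tendsto (fun h : ℝ≥0 => (((h : ℝ) : 𝕜))⁻¹ • (T h f - f)) (𝓝[>] 0) (𝓝 g)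

/-- The Laplace transform `R f` of an orbit lies in the domain of the generator, which maps it to
`lam R f - f`. The reason is that `T h (R f) = e^{lam h} (R f - ∫_0^h e^{-lam s} T s f ds)`. -/
lemma IsC0Semigroup.isRightDeriv_laplace [CompleteSpace X] [IsScalarTower ℝ 𝕜 X]
    {T : ℝ≥0 → X →L[𝕜] X} (hT : IsC0Semigroup T) {lam : 𝕜} {f c : X}
    (hc : HasLaplace lam (fun t : ℝ => T t.toNNReal f) c) :
    IsRightDeriv T c (lam • c - f) := by
  have : SMulCommClass ℝ 𝕜 X := IsScalarTower.to_smulCommClass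
  set G : ℝ → X := fun t => expWeight lam t • T t.toNNReal f with hG
  have hGc : Continuous G := hT.continuous_weighted lam f
  obtain ⟨hi, hc⟩ : IntegrableOn G (Ioi 0) volume ∧ ∫ t in Ioi (0 : ℝ), G t = c := hc
  have hTh : ∀ h : ℝ≥0, T h c = expWeight (-lam) h • (c - ∫ s in (0 : ℝ)..h, G s) := by
    intro h
    have e1 : ∫ s in Ioi (h : ℝ), G s = c - ∫ s in (0 : ℝ)..h, G s := by
      rw [← hc, eq_sub_iff_add_eq', intervalIntegral.integral_interval_add_Ioi hi
        (hi.mono_set (Ioi_subset_Ioi h.coe_nonneg))]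
    have e2 : ∫ t in Ioi (0 : ℝ), G (t + h) = ∫ s in Ioi (h : ℝ), G s := by
      have := (measurePreserving_add_right volume (h : ℝ)).setIntegral_preimage_emb
        (measurableEmbedding_addRight (h : ℝ)) G (Ioi (h : ℝ))
      rw [← this]
      congr 2
      simp
    rw [← e1, ← e2, ← integral_smul, ← hc, ← ContinuousLinearMap.integral_comp_comm _ hi]
    refine setIntegral_congr_fun measurableSet_Ioi fun t ht => ?_
    have e3 : (t + h).toNNReal = h + t.toNNReal := by
      rw [Real.toNNReal_add (le_of_lt ht) h.coe_nonneg, Real.toNNReal_coe, add_comm]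
    have e4 : expWeight (-lam) h * expWeight lam h = 1 := by
      have : expWeight (-lam) (h : ℝ) = expWeight lam (-h) := by simp [expWeight]
      rw [this, ← expWeight_add]
      simp
    simp only [hG, map_smul, e3, hT.map_add, ContinuousLinearMap.comp_apply]
    rw [smul_smul, expWeight_add, mul_left_comm, e4, mul_one]
  set D : ℝ → X := fun h => expWeight (-lam) h • (c - ∫ s in (0 : ℝ)..h, G s) with hD
  have hD0 : D 0 = c := by simp [hD]
  have hG0 : G 0 = f := by simp [hG, hT.map_zero]
  have hder : HasDerivAt D (lam • c - f) 0 := by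
    have h1 : HasDerivAt (fun h => c - ∫ s in (0 : ℝ)..h, G s) (-f) 0 := by
      have := intervalIntegral.integral_hasDerivAt_right (hGc.intervalIntegrable 0 0)
        hGc.stronglyMeasurable.stronglyMeasurableAtFilter hGc.continuousAt
      rw [hG0] at this
      exact this.const_sub c
    have := (hasDerivAt_expWeight (-lam) 0).smul h1
    refine this.congr_deriv ?_
    simp
    abel
  have hlim := (hasDerivAt_iff_tendsto_slope_zero.1 hder)
  have hmap : Tendsto (fun h : ℝ≥0 => (h : ℝ)) (𝓝[>] 0) (𝓝[≠] 0) := by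
    refine tendsto_nhdsWithin_iff.2 ⟨?_, ?_⟩
    · exact (NNReal.continuous_coe.tendsto 0).mono_left nhdsWithin_le_nhds
    · filter_upwards [self_mem_nhdsWithin] with h hh
      have : (0 : ℝ≥0) < h := hh
      exact (NNReal.coe_pos.2 this).ne'
  refine (hlim.comp hmap).congr fun h => ?_
  simp only [Function.comp_apply, zero_add, hD0]
  rw [hTh h, RCLike.real_smul_eq_coe_smul (K := 𝕜), RCLike.ofReal_inv]

/-- The Laplace transform is a left inverse of `lam` minus the generator. -/
lemma IsC0Semigroup.laplace_sub_eq [CompleteSpace X] [IsScalarTower ℝ 𝕜 X]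
    {T : ℝ≥0 → X →L[𝕜] X} (hT : IsC0Semigroup T) {lam : 𝕜} {R : X →L[𝕜] X}
    (hR : ∀ f, HasLaplace lam (fun t : ℝ => T t.toNNReal f) (R f)) {f g : X}
    (hfg : IsRightDeriv T f g) : R (lam • f - g) = f := by
  have hcomm : ∀ h : ℝ≥0, R (T h f) = T h (R f) := by
    intro h
    rw [← (hR (T h f)).2, ← (hR f).2, ← ContinuousLinearMap.integral_comp_comm _ (hR f).1]
    refine integral_congr_ae (Eventually.of_forall fun t => ?_)
    simp only [map_smul]
    rw [← ContinuousLinearMap.comp_apply, ← ContinuousLinearMap.comp_apply, ← hT.map_add,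
      ← hT.map_add, add_comm]
  have h1 : Tendsto (fun h : ℝ≥0 => (((h : ℝ) : 𝕜))⁻¹ • (T h (R f) - R f)) (𝓝[>] 0)
      (𝓝 (R g)) := by
    refine ((R.continuous.tendsto g).comp hfg).congr fun h => ?_
    simp [hcomm]
  have h2 := tendsto_nhds_unique h1 (hT.isRightDeriv_laplace (hR f))
  rw [map_sub, map_smul, h2]
  abel

/-- If the generator of `T` is `A`, then the Laplace transform of `T` is the resolvent of `A`. -/
lemma IsC0Semigroup.isResolvent [CompleteSpace X] [IsScalarTower ℝ 𝕜 X]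
    {T : ℝ≥0 → X →L[𝕜] X} (hT : IsC0Semigroup T) {A : X →ₗ.[𝕜] X} (hA : IsGenerator T A)
    {lam : 𝕜} {R : X →L[𝕜] X}
    (hR : ∀ f, HasLaplace lam (fun t : ℝ => T t.toNNReal f) (R f)) : IsResolvent A lam R := by
  have hgr : ∀ f, (R f, lam • R f - f) ∈ A.graph := fun f =>
    (hA _ _).2 (hT.isRightDeriv_laplace (hR f))
  have hdom : ∀ f, R f ∈ A.domain := fun f => LinearPMap.mem_domain_of_mem_graph (hgr f)
  refine ⟨hdom, fun f => ?_, fun f => ?_⟩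
  · have : A ⟨R f, hdom f⟩ = lam • R f - f :=
      LinearPMap.mem_graph_snd_inj A (A.mem_graph ⟨R f, hdom f⟩) (hgr f) rfl
    rw [this]
    abel
  · exact hT.laplace_sub_eq hR ((hA _ _).1 (A.mem_graph f))

end Abstract
end NetworkTransport

namespace NetworkTransport

/-! ### Bochner integrals in `L^p` are computed pointwise -/

section LpIntegral

variable {α β E : Type*} [MeasurableSpace α] [MeasurableSpace β] [NormedAddCommGroup E]
  {p : ℝ≥0∞} [Fact (1 ≤ p)] {μ : Measure α} {ν : Measure β}

lemma integrableOn_Lp (f : Lp E p μ) {A : Set α} (hA : μ A < ⊤) : IntegrableOn f A μ := by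
  have : IsFiniteMeasure (μ.restrict A) := ⟨by simpa using hA⟩
  exact ((Lp.memLp f).restrict A).integrable Fact.out

/-- Hölder's inequality against the indicator of a set of finite measure. -/
lemma exists_setIntegral_norm_le {A : Set α} (hA : μ A < ⊤) :
    ∃ C : ℝ, ∀ f : Lp E p μ, ∫ x in A, ‖f x‖ ∂μ ≤ C * ‖f‖ := by
  refine ⟨((μ A) ^ (1 / (1 : ℝ≥0∞).toReal - 1 / p.toReal)).toReal, fun f => ?_⟩
  have h1 := eLpNorm_le_eLpNorm_mul_rpow_measure_univ (μ := μ.restrict A) (p := 1) (q := p)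
    Fact.out ((Lp.memLp f).restrict A).1
  rw [Measure.restrict_apply_univ] at h1
  have h2 : eLpNorm f p (μ.restrict A) ≤ eLpNorm f p μ :=
    eLpNorm_mono_measure _ Measure.restrict_le_self
  have hne : (μ A) ^ (1 / (1 : ℝ≥0∞).toReal - 1 / p.toReal) ≠ ⊤ := by
    refine (ENNReal.rpow_lt_top_of_nonneg ?_ hA.ne).ne
    rw [ENNReal.toReal_one, div_one, sub_nonneg]
    rcases eq_or_ne p ⊤ with rfl | hp
    · simp
    · have : 1 ≤ p.toReal := by
        rw [← ENNReal.toReal_one]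
        exact ENNReal.toReal_mono hp Fact.out
      exact (div_le_one (by linarith)).2 this
  rw [Lp.norm_def, mul_comm, ← ENNReal.toReal_mul,
    ← ENNReal.toReal_ofReal (integral_nonneg fun x => norm_nonneg (f x)),
    ofReal_integral_norm_eq_lintegral_enorm (integrableOn_Lp f hA),
    ← eLpNorm_one_eq_lintegral_enorm]
  refine ENNReal.toReal_mono (ENNReal.mul_ne_top (Lp.eLpNorm_ne_top f) hne) (h1.trans ?_)
  gcongr

variable [NormedSpace ℝ E] [CompleteSpace E]

/-- Integration over a set of finite measure commutes with Bochner integrals in `L^p`. -/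
lemma setIntegral_integral_Lp {F : β → Lp E p μ} (hF : Integrable F ν) {A : Set α}
    (hA : μ A < ⊤) :
    ∫ x in A, (∫ t, F t ∂ν : Lp E p μ) x ∂μ = ∫ t, ∫ x in A, F t x ∂μ ∂ν := by
  obtain ⟨C, hC⟩ := exists_setIntegral_norm_le (E := E) (p := p) hA
  let L₀ : Lp E p μ →ₗ[ℝ] E :=
    { toFun := fun f => ∫ x in A, f x ∂μ
      map_add' := fun f g => by
        rw [← integral_add (integrableOn_Lp f hA) (integrableOn_Lp g hA)]
        exact integral_congr_ae (ae_restrict_of_ae (Lp.coeFn_add f g))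
      map_smul' := fun c f => by
        rw [RingHom.id_apply, ← integral_smul]
        exact integral_congr_ae (ae_restrict_of_ae (Lp.coeFn_smul c f)) }
  let L : Lp E p μ →L[ℝ] E := L₀.mkContinuous C fun f =>
    (norm_integral_le_integral_norm _).trans (hC f)
  exact (L.integral_comp_comm hF).symm

/-- If `F` is a Bochner integrable family in `L^p` and `K` is a jointly measurable choice of
representatives, then the integral of `F` is represented by the pointwise integral of `K`. -/
theorem ae_integral_Lp_eq [SigmaFinite μ] [SigmaFinite ν] {F : β → Lp E p μ}
    (hF : Integrable F ν) {K : β × α → E} (hK : AEStronglyMeasurable K (ν.prod μ))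
    (hFK : ∀ᵐ t ∂ν, F t =ᵐ[μ] fun x => K (t, x)) :
    ∀ᵐ x ∂μ, Integrable (fun t => K (t, x)) ν ∧
      (∫ t, F t ∂ν : Lp E p μ) x = ∫ t, K (t, x) ∂ν := by
  -- Over a set of finite measure the `L^1` norm is dominated by the `L^p` norm.
  have hint : ∀ A : Set α, μ A < ⊤ → Integrable K (ν.prod (μ.restrict A)) := by
    intro A hA
    obtain ⟨C, hC⟩ := exists_setIntegral_norm_le (E := E) (p := p) hA
    have hK' : AEStronglyMeasurable K (ν.prod (μ.restrict A)) :=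
      hK.mono_ac (Measure.AbsolutelyContinuous.rfl.prod
        Measure.restrict_le_self.absolutelyContinuous)
    rw [integrable_prod_iff hK']
    refine ⟨?_, ?_⟩
    · filter_upwards [hFK] with t ht
      exact (integrableOn_Lp (F t) hA).congr (ae_restrict_of_ae ht)
    · refine (hF.norm.const_mul C).mono' hK'.norm.integral_prod_right' ?_
      filter_upwards [hFK] with t ht
      rw [Real.norm_of_nonneg (integral_nonneg fun x => norm_nonneg _)]
      refine le_trans (le_of_eq ?_) (hC (F t))
      refine integral_congr_ae (ae_restrict_of_ae ?_)
      filter_upwards [ht] with x hx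
      rw [hx]
  have h1 : ∀ᵐ x ∂μ, Integrable (fun t => K (t, x)) ν := by
    have := fun n => (hint _ (measure_spanningSets_lt_top μ n)).prod_left_ae
    rw [← Measure.restrict_univ (μ := μ), ← iUnion_spanningSets μ, ae_restrict_iUnion_iff]
    exact this
  have h2 : (∫ t, F t ∂ν : Lp E p μ) =ᵐ[μ] fun x => ∫ t, K (t, x) ∂ν := by
    refine ae_eq_of_forall_setIntegral_eq_of_sigmaFinite (fun A _ hA => integrableOn_Lp _ hA)
      (fun A _ hA => (hint A hA).integral_prod_right) fun A _ hA => ?_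
    rw [setIntegral_integral_Lp hF hA,
      ← integral_integral_swap (f := fun t x => K (t, x)) (hint A hA)]
    refine integral_congr_ae ?_
    filter_upwards [hFK] with t ht
    exact integral_congr_ae (ae_restrict_of_ae ht)
  filter_upwards [h1, h2] with x hx hx'
  exact ⟨hx, hx'⟩

end LpIntegral

/-! ### Extension of the data beyond the edges -/

lemma ae_comp_add_right {P : ℝ → Prop} (h : ∀ᵐ y : ℝ, P y) (a : ℝ) : ∀ᵐ y : ℝ, P (y + a) :=
  (measurePreserving_add_right volume a).quasiMeasurePreserving.ae h

lemma ae_comp_sub_left {P : ℝ → Prop} (h : ∀ᵐ y : ℝ, P y) (a : ℝ) : ∀ᵐ y : ℝ, P (a - y) :=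
  (Measure.measurePreserving_sub_left volume a).quasiMeasurePreserving.ae h

lemma ae_ne_intCast : ∀ᵐ y : ℝ, ∀ z : ℤ, y ≠ z := by
  filter_upwards [(countable_range ((↑) : ℤ → ℝ)).ae_notMem volume] with y hy z hz
  exact hy ⟨z, hz.symm⟩

section Extension

variable {𝕜 : Type*} [RCLike 𝕜] {m q r : ℕ}
  (B : Matrix (Fin m ⊕ Fin q) (Fin m ⊕ Fin r) 𝕜)

/-- The datum on the bounded edges, continued to the left of `0` so that the solution is a
translate of it: `u(x, t) = extU (x - t)`. This is the solution formula with `x - t = y`; the number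
of passages through the vertex is `⌈-y⌉₊`, which is `0` for `y ≥ 0`. -/
noncomputable def extU (u : ℝ → Fin m → 𝕜) (w : ℝ → Fin r → 𝕜) (y : ℝ) : Fin m → 𝕜 :=
  (B.toBlocks₁₁ ^ ⌈-y⌉₊) *ᵥ u (⌈-y⌉₊ + y) +
    ∑ k ∈ Finset.range ⌈-y⌉₊, (B.toBlocks₁₁ ^ k * B.toBlocks₁₂) *ᵥ w (-y - k)

/-- The datum on the outgoing unbounded edges, continued to the left of `0` so that
`v(x, t) = extV (x - t)`. It is given by the boundary condition rather than by the closed formula;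
the two agree unless `y` is an integer. -/
noncomputable def extV (u : ℝ → Fin m → 𝕜) (v : ℝ → Fin q → 𝕜) (w : ℝ → Fin r → 𝕜) (y : ℝ) :
    Fin q → 𝕜 :=
  if 0 < y then v y else B.toBlocks₂₁ *ᵥ extU B u w (y + 1) + B.toBlocks₂₂ *ᵥ w (-y)

variable {B}

lemma extU_of_nonneg (u : ℝ → Fin m → 𝕜) (w : ℝ → Fin r → 𝕜) {y : ℝ} (hy : 0 ≤ y) :
    extU B u w y = u y := by
  have : ⌈-y⌉₊ = 0 := Nat.ceil_eq_zero.2 (by linarith)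
  simp [extU, this]

/-- The boundary condition, as a recursion for the extended datum. -/
lemma extU_of_neg (u : ℝ → Fin m → 𝕜) (w : ℝ → Fin r → 𝕜) {y : ℝ} (hy : y < 0) :
    extU B u w y = B.toBlocks₁₁ *ᵥ extU B u w (y + 1) + B.toBlocks₁₂ *ᵥ w (-y) := by
  have h : ⌈-y⌉₊ = ⌈-(y + 1)⌉₊ + 1 := by
    rcases le_or_gt (-1) y with h1 | h1
    · have e1 : ⌈-(y + 1)⌉₊ = 0 := Nat.ceil_eq_zero.2 (by linarith)
      rw [e1, Nat.ceil_eq_iff (by simp)]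
      constructor <;> push_cast <;> linarith
    · rw [← Nat.ceil_add_one (by linarith)]
      congr 1
      ring
  have e1 : ((⌈-(y + 1)⌉₊ + 1 : ℕ) : ℝ) + y = ⌈-(y + 1)⌉₊ + (y + 1) := by
    push_cast
    ring
  have e2 : ∀ k : ℕ, -y - ((k + 1 : ℕ) : ℝ) = -(y + 1) - k := fun k => by
    push_cast
    ring
  simp only [extU, h, Finset.sum_range_succ', e1, e2, Matrix.mulVec_add, Matrix.mulVec_mulVec,
    Matrix.mulVec_sum, ← pow_succ', ← Matrix.mul_assoc, pow_zero, Matrix.one_mul, Nat.cast_zero,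
    sub_zero, add_assoc]

lemma solU_eq_extU (u : ℝ → Fin m → 𝕜) (w : ℝ → Fin r → 𝕜) (t x : ℝ) :
    solU B u w t x = extU B u w (x - t) := by
  simp only [solU, extU, uIndex, neg_sub]
  rw [show (⌈t - x⌉₊ : ℝ) - t + x = ⌈t - x⌉₊ + (x - t) by ring]

/-- At integer values of `x - t` the two sides may use different integers `n`, and differ. -/
lemma solV_eq_extV (u : ℝ → Fin m → 𝕜) (v : ℝ → Fin q → 𝕜) (w : ℝ → Fin r → 𝕜) {t x : ℝ}
    (h : ∀ z : ℤ, x - t ≠ z) : solV B u v w t x = extV B u v w (x - t) := by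
  rcases lt_trichotomy x t with hx | rfl | hx
  · rw [solV, if_neg (not_lt.2 hx.le), if_pos hx, extV, if_neg (by linarith), neg_sub]
    have e : vIndex t x = ⌈-(x - t + 1)⌉₊ := by
      have h' : ∀ z : ℤ, t - x ≠ z := fun z hz => h (-z) (by push_cast; linarith)
      obtain ⟨h1, h2⟩ := (vIndex_iff hx h' _).2 rfl
      symm
      rcases Nat.eq_zero_or_pos (vIndex t x) with h0 | h0
      · rw [h0] at h1 ⊢
        push_cast at h1
        exact Nat.ceil_eq_zero.2 (by linarith)
      · rw [Nat.ceil_eq_iff h0.ne', Nat.cast_sub h0]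
        push_cast
        constructor <;> linarith
    have e2 : ∀ k : ℕ, -(x - t + 1) - (k : ℝ) = t - x - k - 1 := fun k => by ring
    simp only [extU, ← e, e2, Matrix.mulVec_add, Matrix.mulVec_mulVec]
    rw [show (vIndex t x : ℝ) - t + x + 1 = vIndex t x + (x - t + 1) by ring]
  · exact absurd (sub_self x) (by simpa using h 0)
  · rw [solV, if_pos hx, extV, if_pos (by linarith)]

lemma measurable_mulVec_comp {a b : ℕ} {F : ℝ → Fin b → 𝕜} (hF : Measurable F)
    (M : Matrix (Fin a) (Fin b) 𝕜) : Measurable fun y => M *ᵥ F y := by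
  have h : Measurable fun c : Fin b → 𝕜 => M *ᵥ c :=
    (Continuous.matrix_mulVec continuous_const continuous_id).measurable
  exact h.comp hF

lemma measurable_extU {u : ℝ → Fin m → 𝕜} {w : ℝ → Fin r → 𝕜} (hu : Measurable u)
    (hw : Measurable w) : Measurable (extU B u w) := by
  have h1 : Measurable fun x : ℕ × ℝ => (B.toBlocks₁₁ ^ x.1) *ᵥ u (x.1 + x.2) +
      ∑ k ∈ Finset.range x.1, (B.toBlocks₁₁ ^ k * B.toBlocks₁₂) *ᵥ w (-x.2 - k) := by
    refine measurable_from_prod_countable_right fun n => ?_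
    have e1 : Measurable fun y : ℝ => (B.toBlocks₁₁ ^ n) *ᵥ u (n + y) :=
      measurable_mulVec_comp (hu.comp (measurable_const_add _)) _
    have e2 : ∀ k : ℕ, Measurable fun y : ℝ =>
        (B.toBlocks₁₁ ^ k * B.toBlocks₁₂) *ᵥ w (-y - k) := fun k =>
      measurable_mulVec_comp (hw.comp (measurable_neg.sub_const _)) _
    exact e1.add (Finset.measurable_fun_sum (Finset.range n) fun k _ => e2 k)
  have h2 : Measurable fun y : ℝ => (⌈-y⌉₊, y) :=
    (Nat.measurable_ceil.comp measurable_neg).prodMk measurable_id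
  exact h1.comp h2

lemma measurable_extV {u : ℝ → Fin m → 𝕜} {v : ℝ → Fin q → 𝕜} {w : ℝ → Fin r → 𝕜}
    (hu : Measurable u) (hv : Measurable v) (hw : Measurable w) :
    Measurable (extV B u v w) := by
  have h1 : Measurable fun y => B.toBlocks₂₁ *ᵥ extU B u w (y + 1) :=
    measurable_mulVec_comp ((measurable_extU hu hw).comp (measurable_add_const 1)) _
  have h2 : Measurable fun y => B.toBlocks₂₂ *ᵥ w (-y) :=
    measurable_mulVec_comp (hw.comp measurable_neg) _
  exact Measurable.ite measurableSet_Ioi hv (h1.add h2)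

end Extension

section Relation

variable {𝕜 : Type*} [RCLike 𝕜] {p : ℝ≥0∞} {m q r : ℕ}
  {B : Matrix (Fin m ⊕ Fin q) (Fin m ⊕ Fin r) 𝕜}

variable (B) in
/-- The extended datum on the bounded edges belonging to a state. -/
noncomputable abbrev stateU (f : StateSpace 𝕜 p m q r) : ℝ → Fin m → 𝕜 :=
  extU B (uFun f) (wFun f)

variable (B) in
/-- The extended datum on the outgoing unbounded edges belonging to a state. -/
noncomputable abbrev stateV (f : StateSpace 𝕜 p m q r) : ℝ → Fin q → 𝕜 :=
  extV B (uFun f) (vFun f) (wFun f)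

lemma measurable_uFun (f : StateSpace 𝕜 p m q r) : Measurable (uFun f) :=
  measurable_pi_iff.2 fun j => (Lp.stronglyMeasurable (f.1 j)).measurable

lemma measurable_vFun (f : StateSpace 𝕜 p m q r) : Measurable (vFun f) :=
  measurable_pi_iff.2 fun j => (Lp.stronglyMeasurable (f.2.1 j)).measurable

lemma measurable_wFun (f : StateSpace 𝕜 p m q r) : Measurable (wFun f) :=
  measurable_pi_iff.2 fun j => (Lp.stronglyMeasurable (f.2.2 j)).measurable

lemma measurable_stateU (f : StateSpace 𝕜 p m q r) : Measurable (stateU B f) :=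
  measurable_extU (measurable_uFun f) (measurable_wFun f)

lemma measurable_stateV (f : StateSpace 𝕜 p m q r) : Measurable (stateV B f) :=
  measurable_extV (measurable_uFun f) (measurable_vFun f) (measurable_wFun f)

lemma stateU_of_nonneg (f : StateSpace 𝕜 p m q r) {y : ℝ} (hy : 0 ≤ y) :
    stateU B f y = uFun f y :=
  extU_of_nonneg _ _ hy

lemma stateU_of_neg (f : StateSpace 𝕜 p m q r) {y : ℝ} (hy : y < 0) :
    stateU B f y = B.toBlocks₁₁ *ᵥ stateU B f (y + 1) + B.toBlocks₁₂ *ᵥ wFun f (-y) :=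
  extU_of_neg _ _ hy

lemma stateV_of_pos (f : StateSpace 𝕜 p m q r) {y : ℝ} (hy : 0 < y) :
    stateV B f y = vFun f y :=
  if_pos hy

lemma stateV_of_nonpos (f : StateSpace 𝕜 p m q r) {y : ℝ} (hy : y ≤ 0) :
    stateV B f y = B.toBlocks₂₁ *ᵥ stateU B f (y + 1) + B.toBlocks₂₂ *ᵥ wFun f (-y) :=
  if_neg (not_lt.2 hy)

variable (B) in
/-- The state `h` is the solution with datum `f` at time `t`: its components are translates of the
extended data of `f`. -/
structure IsSolutionAt (t : ℝ) (f h : StateSpace 𝕜 p m q r) : Prop where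
  u : ∀ᵐ y : ℝ, 0 < y → y < 1 → uFun h y = stateU B f (y - t)
  v : ∀ᵐ y : ℝ, 0 < y → vFun h y = stateV B f (y - t)
  w : ∀ᵐ y : ℝ, 0 < y → wFun h y = wFun f (y + t)

lemma ae_forall_comp_iff {E : Type*} {s : Set ℝ} (hs : MeasurableSet s) {n : ℕ}
    {F G : ℝ → Fin n → E} :
    (∀ j, (fun x => F x j) =ᵐ[volume.restrict s] fun x => G x j) ↔
      ∀ᵐ y : ℝ, y ∈ s → F y = G y := by
  rw [← ae_restrict_iff' hs]
  simp only [funext_iff, ae_all_iff]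
  rfl

lemma isSolutionAt_iff {t : ℝ} {f h : StateSpace 𝕜 p m q r} :
    IsSolutionAt B t f h ↔
      (∀ j, h.1 j =ᵐ[muB] fun x => formulaU B f t x j) ∧
      (∀ j, h.2.1 j =ᵐ[muU] fun x => formulaV B f t x j) ∧
      (∀ j, h.2.2 j =ᵐ[muU] fun x => formulaW f t x j) := by
  have hZ : ∀ᵐ y : ℝ, ∀ z : ℤ, y - t ≠ z := by
    simpa [sub_eq_add_neg] using ae_comp_add_right ae_ne_intCast (-t)
  have e1 := ae_forall_comp_iff (measurableSet_Ioo (a := (0 : ℝ)) (b := 1))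
    (F := uFun h) (G := formulaU B f t)
  have e2 := ae_forall_comp_iff (measurableSet_Ioi (a := (0 : ℝ)))
    (F := vFun h) (G := formulaV B f t)
  have e3 := ae_forall_comp_iff (measurableSet_Ioi (a := (0 : ℝ)))
    (F := wFun h) (G := formulaW f t)
  have e4 : (∀ᵐ y : ℝ, y ∈ Ioi (0 : ℝ) → vFun h y = formulaV B f t y) ↔
      ∀ᵐ y : ℝ, 0 < y → vFun h y = stateV B f (y - t) := by
    refine eventually_congr (hZ.mono fun y hy => ?_)
    rw [formulaV, solV_eq_extV _ _ _ hy, mem_Ioi]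
  constructor
  · intro hs
    refine ⟨e1.2 ?_, e2.2 (e4.2 hs.v), e3.2 hs.w⟩
    filter_upwards [hs.u] with y hy hy'
    rw [hy hy'.1 hy'.2, formulaU, solU_eq_extU]
  · rintro ⟨h1, h2, h3⟩
    refine ⟨?_, e4.1 (e2.1 h2), e3.1 h3⟩
    filter_upwards [e1.1 h1] with y hy h0 h1
    rw [hy ⟨h0, h1⟩, formulaU, solU_eq_extU]

/-- Solutions propagate the whole extended datum on the bounded edges. The recursion
`extU_of_neg` carries the identity from one unit interval to the next one on its left. -/
lemma IsSolutionAt.stateU_eq {t : ℝ} (ht : 0 ≤ t) {f h : StateSpace 𝕜 p m q r}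
    (hs : IsSolutionAt B t f h) : ∀ᵐ y : ℝ, y < 1 → stateU B h y = stateU B f (y - t) := by
  have key : ∀ n : ℕ, ∀ᵐ y : ℝ, -(n : ℝ) < y → y < 1 → stateU B h y = stateU B f (y - t) := by
    intro n
    induction n with
    | zero =>
      filter_upwards [hs.u] with y hy h0 h1
      rw [Nat.cast_zero, neg_zero] at h0
      rw [stateU_of_nonneg _ h0.le, hy h0 h1]
    | succ n ih =>
      filter_upwards [ih, ae_comp_add_right ih 1, ae_comp_sub_left hs.w 0,
        Measure.ae_ne volume 0] with y h1 h2 h3 h4 h5 h6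
      rcases lt_or_gt_of_ne h4 with h7 | h7
      · push_cast at h5
        rw [zero_sub] at h3
        rw [stateU_of_neg _ h7, stateU_of_neg (y := y - t) _ (by linarith),
          h2 (by linarith) (by linarith), h3 (by linarith), neg_sub', sub_neg_eq_add,
          add_sub_right_comm]
      · refine h1 ?_ h6
        have : (0 : ℝ) ≤ n := n.cast_nonneg
        linarith
  filter_upwards [ae_all_iff.2 key] with y hy h1
  obtain ⟨n, hn⟩ := exists_nat_gt (-y)
  exact hy n (by linarith) h1

lemma IsSolutionAt.stateV_eq {t : ℝ} (ht : 0 ≤ t) {f h : StateSpace 𝕜 p m q r}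
    (hs : IsSolutionAt B t f h) : ∀ᵐ y : ℝ, stateV B h y = stateV B f (y - t) := by
  filter_upwards [hs.v, ae_comp_add_right (hs.stateU_eq ht) 1, ae_comp_sub_left hs.w 0,
    Measure.ae_ne volume 0] with y h1 h2 h3 h4
  rcases lt_or_gt_of_ne h4 with h7 | h7
  · rw [zero_sub] at h3
    rw [stateV_of_nonpos _ h7.le, stateV_of_nonpos (y := y - t) _ (by linarith),
      h2 (by linarith), h3 (by linarith), neg_sub', sub_neg_eq_add, add_sub_right_comm]
  · rw [stateV_of_pos _ h7, h1 h7]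

lemma IsSolutionAt.trans {s t : ℝ} (hs : 0 ≤ s) (ht : 0 ≤ t) {f h k : StateSpace 𝕜 p m q r}
    (h1 : IsSolutionAt B t f h) (h2 : IsSolutionAt B s h k) : IsSolutionAt B (s + t) f k := by
  refine ⟨?_, ?_, ?_⟩
  · filter_upwards [h2.u, ae_comp_add_right (h1.stateU_eq ht) (-s)] with y a b c d
    rw [a c d, sub_eq_add_neg y s, b (by linarith)]
    congr 1
    ring
  · filter_upwards [h2.v, ae_comp_add_right (h1.stateV_eq ht) (-s)] with y a b c
    rw [a c, sub_eq_add_neg y s, b]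
    congr 1
    ring
  · filter_upwards [h2.w, ae_comp_add_right h1.w s] with y a b c
    rw [a c, b (by linarith), add_assoc]

lemma IsSolutionAt.unique {t : ℝ} {f h k : StateSpace 𝕜 p m q r}
    (h1 : IsSolutionAt B t f h) (h2 : IsSolutionAt B t f k) : h = k := by
  obtain ⟨a1, a2, a3⟩ := isSolutionAt_iff.1 h1
  obtain ⟨b1, b2, b3⟩ := isSolutionAt_iff.1 h2
  exact Prod.ext (funext fun j => Lp.ext ((a1 j).trans (b1 j).symm))
    (Prod.ext (funext fun j => Lp.ext ((a2 j).trans (b2 j).symm))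
      (funext fun j => Lp.ext ((a3 j).trans (b3 j).symm)))

end Relation

/-! ### Translations between edges -/

section Pull

variable {𝕜 : Type*} [RCLike 𝕜] {p : ℝ≥0∞}

lemma coeFn_sum_smul {s : Set ℝ} {n : ℕ} (c : Fin n → 𝕜)
    {f : Fin n → Lp 𝕜 p (volume.restrict s)} {F : Fin n → ℝ → 𝕜}
    (hF : ∀ j, f j =ᵐ[volume.restrict s] F j) :
    (∑ j, c j • f j : Lp 𝕜 p (volume.restrict s)) =ᵐ[volume.restrict s]
      fun x => ∑ j, c j * F j x := by
  have h : ∀ S : Finset (Fin n), (∑ j ∈ S, c j • f j : Lp 𝕜 p (volume.restrict s))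
      =ᵐ[volume.restrict s] fun x => ∑ j ∈ S, c j * F j x := by
    intro S
    induction S using Finset.induction_on with
    | empty => exact Lp.coeFn_zero _ _ _
    | insert a S ha ih =>
      simp only [Finset.sum_insert ha]
      filter_upwards [Lp.coeFn_add (c a • f a) (∑ j ∈ S, c j • f j), Lp.coeFn_smul (c a) (f a),
        ih, hF a] with x h1 h2 h3 h4
      rw [h1, Pi.add_apply, h2, h3, Pi.smul_apply, h4, smul_eq_mul]
  exact h Finset.univ

lemma coeFn_add_sum_smul {s : Set ℝ} {n k : ℕ} {g : Lp 𝕜 p (volume.restrict s)} {G : ℝ → 𝕜}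
    (hG : g =ᵐ[volume.restrict s] G) (c : Fin n → 𝕜) (d : Fin k → 𝕜)
    {f : Fin n → Lp 𝕜 p (volume.restrict s)} {F : Fin n → ℝ → 𝕜}
    (hF : ∀ j, f j =ᵐ[volume.restrict s] F j)
    {f' : Fin k → Lp 𝕜 p (volume.restrict s)} {F' : Fin k → ℝ → 𝕜}
    (hF' : ∀ j, f' j =ᵐ[volume.restrict s] F' j) :
    (g + ∑ j, c j • f j + ∑ j, d j • f' j : Lp 𝕜 p (volume.restrict s)) =ᵐ[volume.restrict s]
      fun x => G x + ∑ j, c j * F j x + ∑ j, d j * F' j x := by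
  filter_upwards [Lp.coeFn_add (g + ∑ j, c j • f j) (∑ j, d j • f' j),
    Lp.coeFn_add g (∑ j, c j • f j), coeFn_sum_smul c hF, coeFn_sum_smul d hF', hG]
    with x h1 h2 h3 h4 h5
  rw [h1, Pi.add_apply, h2, Pi.add_apply, h3, h4, h5]

/-- Extension by zero from a measurable set to the whole line, as a map. -/
noncomputable def extendZeroFun {s : Set ℝ} (hs : MeasurableSet s)
    (f : Lp 𝕜 p (volume.restrict s)) : Lp 𝕜 p (volume : Measure ℝ) :=
  MemLp.toLp (s.indicator f) ((memLp_indicator_iff_restrict hs).2 (Lp.memLp f))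

lemma coeFn_extendZeroFun {s : Set ℝ} (hs : MeasurableSet s) (f : Lp 𝕜 p (volume.restrict s)) :
    extendZeroFun hs f =ᵐ[volume] s.indicator f :=
  MemLp.coeFn_toLp _

lemma extendZeroFun_add {s : Set ℝ} (hs : MeasurableSet s) (f g : Lp 𝕜 p (volume.restrict s)) :
    extendZeroFun hs (f + g) = extendZeroFun hs f + extendZeroFun hs g := by
  refine Lp.ext ?_
  filter_upwards [(ae_restrict_iff' hs).1 (Lp.coeFn_add f g), coeFn_extendZeroFun hs (f + g),
    coeFn_extendZeroFun hs f, coeFn_extendZeroFun hs g,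
    Lp.coeFn_add (extendZeroFun hs f) (extendZeroFun hs g)] with x h1 h2 h3 h4 h5
  rw [h2, h5, Pi.add_apply, h3, h4]
  by_cases hx : x ∈ s
  · rw [indicator_of_mem hx, indicator_of_mem hx, indicator_of_mem hx, h1 hx, Pi.add_apply]
  · simp [hx]

lemma extendZeroFun_smul {s : Set ℝ} (hs : MeasurableSet s) (c : 𝕜)
    (f : Lp 𝕜 p (volume.restrict s)) :
    extendZeroFun hs (c • f) = c • extendZeroFun hs f := by
  refine Lp.ext ?_
  filter_upwards [(ae_restrict_iff' hs).1 (Lp.coeFn_smul c f), coeFn_extendZeroFun hs (c • f),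
    coeFn_extendZeroFun hs f, Lp.coeFn_smul c (extendZeroFun hs f)] with x h1 h2 h3 h4
  rw [h2, h4, Pi.smul_apply, h3]
  by_cases hx : x ∈ s
  · simp [hx, h1 hx]
  · simp [hx]

lemma norm_extendZeroFun {s : Set ℝ} (hs : MeasurableSet s) (f : Lp 𝕜 p (volume.restrict s)) :
    ‖extendZeroFun hs f‖ = ‖f‖ := by
  rw [extendZeroFun, Lp.norm_toLp, eLpNorm_indicator_eq_eLpNorm_restrict hs, Lp.norm_def]

variable [Fact (1 ≤ p)]

/-- Extension by zero from a measurable set to the whole line. -/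
noncomputable def extendZero {s : Set ℝ} (hs : MeasurableSet s) :
    Lp 𝕜 p (volume.restrict s) →ₗᵢ[𝕜] Lp 𝕜 p (volume : Measure ℝ) where
  toFun := extendZeroFun hs
  map_add' := extendZeroFun_add hs
  map_smul' := extendZeroFun_smul hs
  norm_map' := norm_extendZeroFun hs

lemma coeFn_extendZero {s : Set ℝ} (hs : MeasurableSet s) (f : Lp 𝕜 p (volume.restrict s)) :
    extendZero hs f =ᵐ[volume] s.indicator f :=
  coeFn_extendZeroFun hs f

/-- The operator `f ↦ (f ∘ e)|_{s'}`, where `f` is extended from `s` to the line by zero. -/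
noncomputable def pull {s : Set ℝ} (hs : MeasurableSet s) (s' : Set ℝ) (e : C(ℝ, ℝ))
    (he : MeasurePreserving e volume volume) :
    Lp 𝕜 p (volume.restrict s) →L[𝕜] Lp 𝕜 p (volume.restrict s') :=
  (LpToLpRestrictCLM ℝ 𝕜 𝕜 volume p s').comp
    ((Lp.compMeasurePreservingₗᵢ 𝕜 e he).comp (extendZero hs)).toContinuousLinearMap

lemma coeFn_pull {s : Set ℝ} (hs : MeasurableSet s) (s' : Set ℝ) (e : C(ℝ, ℝ))
    (he : MeasurePreserving e volume volume) (f : Lp 𝕜 p (volume.restrict s)) :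
    pull hs s' e he f =ᵐ[volume.restrict s'] fun x => s.indicator f (e x) := by
  have h1 := LpToLpRestrictCLM_coeFn 𝕜 s' (Lp.compMeasurePreserving e he (extendZero hs f))
  have h2 := Lp.coeFn_compMeasurePreserving (extendZero hs f) he
  have h3 := he.quasiMeasurePreserving.ae (coeFn_extendZero hs f)
  filter_upwards [h1, ae_restrict_of_ae h2, ae_restrict_of_ae h3] with x e1 e2 e3
  exact e1.trans (e2.trans e3)

lemma continuous_pull (hp : p ≠ ⊤) {s : Set ℝ} (hs : MeasurableSet s) (s' : Set ℝ)
    {e : ℝ → C(ℝ, ℝ)} (hc : Continuous e) (he : ∀ a, MeasurePreserving (e a) volume volume)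
    (f : Lp 𝕜 p (volume.restrict s)) : Continuous fun a => pull hs s' (e a) (he a) f := by
  have := Continuous.compMeasurePreservingLp
    (continuous_const (y := extendZero hs f)) hc he hp
  exact (LpToLpRestrictCLM ℝ 𝕜 𝕜 volume p s').continuous.comp this

/-- The translation `x ↦ x + a`. -/
def translation (a : ℝ) : C(ℝ, ℝ) := ⟨fun x => x + a, by fun_prop⟩

/-- The reflection `x ↦ a - x`. -/
def reflection (a : ℝ) : C(ℝ, ℝ) := ⟨fun x => a - x, by fun_prop⟩

lemma continuous_translation : Continuous translation :=
  ContinuousMap.continuous_of_continuous_uncurry _ (by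
    change Continuous fun x : ℝ × ℝ => x.2 + x.1
    fun_prop)

lemma continuous_reflection : Continuous reflection :=
  ContinuousMap.continuous_of_continuous_uncurry _ (by
    change Continuous fun x : ℝ × ℝ => x.1 - x.2
    fun_prop)

lemma measurePreserving_translation (a : ℝ) :
    MeasurePreserving (translation a) volume volume :=
  measurePreserving_add_right volume a

lemma measurePreserving_reflection (a : ℝ) :
    MeasurePreserving (reflection a) volume volume :=
  Measure.measurePreserving_sub_left volume a

end Pull

/-! ### The solution operators -/

section Step

variable {𝕜 : Type*} [RCLike 𝕜] {p : ℝ≥0∞} [Fact (1 ≤ p)] {m q r : ℕ}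
  (B : Matrix (Fin m ⊕ Fin q) (Fin m ⊕ Fin r) 𝕜)

/-- For `0 ≤ t ≤ 1` at most one passage through the vertex takes place before time `t`, and this
operator is the solution operator. It is a matrix of translations and reflections, so that its
boundedness and strong continuity in `t` are those of the translations in `L^p(ℝ)`. -/
noncomputable def stepOp (t : ℝ) : StateSpace 𝕜 p m q r →L[𝕜] StateSpace 𝕜 p m q r :=
  -- Since `pull` extends by zero, each translate or reflection contributes only at the points `x`
  -- that are sent into its edge, and no case distinction `x < t` is needed.
  let prU := fun j : Fin m => (ContinuousLinearMap.proj (R := 𝕜) (φ := fun _ : Fin m => Lp 𝕜 p muB)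
    j).comp (ContinuousLinearMap.fst 𝕜 _ ((Fin q → Lp 𝕜 p muU) × (Fin r → Lp 𝕜 p muU)))
  let prV := fun j : Fin q => (ContinuousLinearMap.proj (R := 𝕜) (φ := fun _ : Fin q => Lp 𝕜 p muU)
    j).comp ((ContinuousLinearMap.fst 𝕜 _ (Fin r → Lp 𝕜 p muU)).comp
      (ContinuousLinearMap.snd 𝕜 (Fin m → Lp 𝕜 p muB) _))
  let prW := fun j : Fin r => (ContinuousLinearMap.proj (R := 𝕜) (φ := fun _ : Fin r => Lp 𝕜 p muU)
    j).comp ((ContinuousLinearMap.snd 𝕜 (Fin q → Lp 𝕜 p muU) _).comp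
      (ContinuousLinearMap.snd 𝕜 (Fin m → Lp 𝕜 p muB) _))
  (ContinuousLinearMap.pi fun i =>
    (pull measurableSet_Ioo (Ioo 0 1) _ (measurePreserving_translation (-t))).comp (prU i) +
    ∑ j, B.toBlocks₁₁ i j •
      (pull measurableSet_Ioo (Ioo 0 1) _ (measurePreserving_translation (1 - t))).comp (prU j) +
    ∑ j, B.toBlocks₁₂ i j •
      (pull measurableSet_Ioi (Ioo 0 1) _ (measurePreserving_reflection t)).comp (prW j)).prod
  ((ContinuousLinearMap.pi fun i =>
    (pull measurableSet_Ioi (Ioi 0) _ (measurePreserving_translation (-t))).comp (prV i) +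
    ∑ j, B.toBlocks₂₁ i j •
      (pull measurableSet_Ioo (Ioi 0) _ (measurePreserving_translation (1 - t))).comp (prU j) +
    ∑ j, B.toBlocks₂₂ i j •
      (pull measurableSet_Ioi (Ioi 0) _ (measurePreserving_reflection t)).comp (prW j)).prod
  (ContinuousLinearMap.pi fun i =>
    (pull measurableSet_Ioi (Ioi 0) _ (measurePreserving_translation t)).comp (prW i)))

lemma stepOp_u (t : ℝ) (f : StateSpace 𝕜 p m q r) (i : Fin m) :
    (stepOp B t f).1 i =
      pull measurableSet_Ioo (Ioo 0 1) _ (measurePreserving_translation (-t)) (f.1 i) +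
      ∑ j, B.toBlocks₁₁ i j •
        pull measurableSet_Ioo (Ioo 0 1) _ (measurePreserving_translation (1 - t)) (f.1 j) +
      ∑ j, B.toBlocks₁₂ i j •
        pull measurableSet_Ioi (Ioo 0 1) _ (measurePreserving_reflection t) (f.2.2 j) := by
  simp [stepOp]

lemma stepOp_v (t : ℝ) (f : StateSpace 𝕜 p m q r) (i : Fin q) :
    (stepOp B t f).2.1 i =
      pull measurableSet_Ioi (Ioi 0) _ (measurePreserving_translation (-t)) (f.2.1 i) +
      ∑ j, B.toBlocks₂₁ i j •
        pull measurableSet_Ioo (Ioi 0) _ (measurePreserving_translation (1 - t)) (f.1 j) +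
      ∑ j, B.toBlocks₂₂ i j •
        pull measurableSet_Ioi (Ioi 0) _ (measurePreserving_reflection t) (f.2.2 j) := by
  simp [stepOp]

lemma stepOp_w (t : ℝ) (f : StateSpace 𝕜 p m q r) (i : Fin r) :
    (stepOp B t f).2.2 i =
      pull measurableSet_Ioi (Ioi 0) _ (measurePreserving_translation t) (f.2.2 i) :=
  rfl

lemma continuous_stepOp (hp : p ≠ ⊤) (f : StateSpace 𝕜 p m q r) :
    Continuous fun t => stepOp B t f := by
  have hT : ∀ {s : Set ℝ} (hs : MeasurableSet s) (s' : Set ℝ) (g : Lp 𝕜 p (volume.restrict s))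
      (a : ℝ → ℝ), Continuous a →
      Continuous fun t => pull hs s' _ (measurePreserving_translation (a t)) g :=
    fun hs s' g _ ha => (continuous_pull hp hs s' continuous_translation
      measurePreserving_translation g).comp ha
  have hR : ∀ {s : Set ℝ} (hs : MeasurableSet s) (s' : Set ℝ) (g : Lp 𝕜 p (volume.restrict s)),
      Continuous fun t => pull hs s' _ (measurePreserving_reflection t) g :=
    fun hs s' g => continuous_pull hp hs s' continuous_reflection measurePreserving_reflection g
  have h1 : Continuous fun t : ℝ => 1 - t := by fun_prop
  have hu : ∀ i, Continuous fun t => (stepOp B t f).1 i := fun i => by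
    simp only [stepOp_u]
    exact ((hT _ _ (f.1 i) _ continuous_neg).add (continuous_finsetSum _ fun j _ =>
      (hT measurableSet_Ioo (Ioo 0 1) (f.1 j) _ h1).const_smul (B.toBlocks₁₁ i j))).add
      (continuous_finsetSum _ fun j _ =>
      (hR measurableSet_Ioi (Ioo 0 1) (f.2.2 j)).const_smul (B.toBlocks₁₂ i j))
  have hv : ∀ i, Continuous fun t => (stepOp B t f).2.1 i := fun i => by
    simp only [stepOp_v]
    exact ((hT _ _ (f.2.1 i) _ continuous_neg).add (continuous_finsetSum _ fun j _ =>
      (hT measurableSet_Ioo (Ioi 0) (f.1 j) _ h1).const_smul (B.toBlocks₂₁ i j))).add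
      (continuous_finsetSum _ fun j _ =>
      (hR measurableSet_Ioi (Ioi 0) (f.2.2 j)).const_smul (B.toBlocks₂₂ i j))
  have hw : ∀ i, Continuous fun t => (stepOp B t f).2.2 i := fun i => by
    simp only [stepOp_w]
    exact hT measurableSet_Ioi (Ioi 0) (f.2.2 i) _ continuous_id
  exact (continuous_pi hu).prodMk ((continuous_pi hv).prodMk (continuous_pi hw))

variable {B}

lemma isSolutionAt_stepOp {t : ℝ} (h0 : 0 ≤ t) (h1 : t ≤ 1) (f : StateSpace 𝕜 p m q r) :
    IsSolutionAt B t f (stepOp B t f) := by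
  refine ⟨?_, ?_, ?_⟩
  · have key : ∀ i, (stepOp B t f).1 i =ᵐ[muB] fun x =>
        (Ioo (0 : ℝ) 1).indicator (f.1 i) (x + -t)
        + ∑ j, B.toBlocks₁₁ i j * (Ioo (0 : ℝ) 1).indicator (f.1 j) (x + (1 - t))
        + ∑ j, B.toBlocks₁₂ i j * (Ioi (0 : ℝ)).indicator (f.2.2 j) (t - x) := by
      intro i
      have := coeFn_add_sum_smul (coeFn_pull measurableSet_Ioo (Ioo 0 1) _
          (measurePreserving_translation (-t)) (f.1 i)) (B.toBlocks₁₁ i) (B.toBlocks₁₂ i)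
        (fun j => coeFn_pull measurableSet_Ioo (Ioo 0 1) _
          (measurePreserving_translation (1 - t)) (f.1 j))
        (fun j => coeFn_pull measurableSet_Ioi (Ioo 0 1) _ (measurePreserving_reflection t)
          (f.2.2 j))
      rwa [← stepOp_u] at this
    have key' := (ae_restrict_iff' measurableSet_Ioo).1 (ae_all_iff.2 key)
    filter_upwards [key', Measure.ae_ne volume t] with x hx hxt hx0 hx1
    have hx := hx ⟨hx0, hx1⟩
    rcases lt_or_gt_of_ne hxt with h | h
    · rw [stateU_of_neg _ (by linarith), stateU_of_nonneg _ (by linarith), neg_sub]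
      ext i
      have e1 : x + -t ∉ Ioo (0 : ℝ) 1 := fun hh => by linarith [hh.1]
      have e2 : x + (1 - t) ∈ Ioo (0 : ℝ) 1 := ⟨by linarith, by linarith⟩
      have e3 : t - x ∈ Ioi (0 : ℝ) := by simpa using h
      refine (hx i).trans ?_
      simp only [indicator_of_notMem e1, indicator_of_mem e2, indicator_of_mem e3, zero_add]
      rw [show x + (1 - t) = x - t + 1 by ring]
      rfl
    · rw [stateU_of_nonneg _ (by linarith)]
      ext i
      have e1 : x + -t ∈ Ioo (0 : ℝ) 1 := ⟨by linarith, by linarith⟩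
      have e2 : x + (1 - t) ∉ Ioo (0 : ℝ) 1 := fun hh => by linarith [hh.2]
      have e3 : t - x ∉ Ioi (0 : ℝ) := by simpa using h.le
      refine (hx i).trans ?_
      simp only [indicator_of_mem e1, indicator_of_notMem e2, indicator_of_notMem e3, mul_zero,
        Finset.sum_const_zero, add_zero]
      rfl
  · have key : ∀ i, (stepOp B t f).2.1 i =ᵐ[muU] fun x =>
        (Ioi (0 : ℝ)).indicator (f.2.1 i) (x + -t)
        + ∑ j, B.toBlocks₂₁ i j * (Ioo (0 : ℝ) 1).indicator (f.1 j) (x + (1 - t))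
        + ∑ j, B.toBlocks₂₂ i j * (Ioi (0 : ℝ)).indicator (f.2.2 j) (t - x) := by
      intro i
      have := coeFn_add_sum_smul (coeFn_pull measurableSet_Ioi (Ioi 0) _
          (measurePreserving_translation (-t)) (f.2.1 i)) (B.toBlocks₂₁ i) (B.toBlocks₂₂ i)
        (fun j => coeFn_pull measurableSet_Ioo (Ioi 0) _
          (measurePreserving_translation (1 - t)) (f.1 j))
        (fun j => coeFn_pull measurableSet_Ioi (Ioi 0) _ (measurePreserving_reflection t)
          (f.2.2 j))
      rwa [← stepOp_v] at this
    have key' := (ae_restrict_iff' measurableSet_Ioi).1 (ae_all_iff.2 key)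
    filter_upwards [key', Measure.ae_ne volume t] with x hx hxt hx0
    have hx := hx hx0
    rcases lt_or_gt_of_ne hxt with h | h
    · rw [stateV_of_nonpos _ (by linarith), stateU_of_nonneg _ (by linarith), neg_sub]
      ext i
      have e1 : x + -t ∉ Ioi (0 : ℝ) := by simpa using h.le
      have e2 : x + (1 - t) ∈ Ioo (0 : ℝ) 1 := ⟨by linarith, by linarith⟩
      have e3 : t - x ∈ Ioi (0 : ℝ) := by simpa using h
      refine (hx i).trans ?_
      simp only [indicator_of_notMem e1, indicator_of_mem e2, indicator_of_mem e3, zero_add]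
      rw [show x + (1 - t) = x - t + 1 by ring]
      rfl
    · rw [stateV_of_pos _ (by linarith)]
      ext i
      have e1 : x + -t ∈ Ioi (0 : ℝ) := by simpa using h
      have e2 : x + (1 - t) ∉ Ioo (0 : ℝ) 1 := fun hh => by linarith [hh.2]
      have e3 : t - x ∉ Ioi (0 : ℝ) := by simpa using h.le
      refine (hx i).trans ?_
      simp only [indicator_of_mem e1, indicator_of_notMem e2, indicator_of_notMem e3, mul_zero,
        Finset.sum_const_zero, add_zero]
      rfl
  · have key : ∀ i, (stepOp B t f).2.2 i =ᵐ[muU] fun x =>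
        (Ioi (0 : ℝ)).indicator (f.2.2 i) (x + t) := fun i =>
      coeFn_pull measurableSet_Ioi (Ioi 0) _ (measurePreserving_translation t) (f.2.2 i)
    have key' := (ae_restrict_iff' measurableSet_Ioi).1 (ae_all_iff.2 key)
    filter_upwards [key'] with x hx hx0
    ext i
    refine (hx hx0 i).trans (indicator_of_mem ?_ _)
    exact add_pos_of_pos_of_nonneg hx0 h0

/-- Longer times are reached by composing solution operators for times at most `1`. -/
lemma exists_solutionOp {t : ℝ} (ht : 0 ≤ t) :
    ∃ L : StateSpace 𝕜 p m q r →L[𝕜] StateSpace 𝕜 p m q r, ∀ f, IsSolutionAt B t f (L f) := by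
  have key : ∀ n : ℕ, ∀ t : ℝ, 0 ≤ t → t ≤ n + 1 →
      ∃ L : StateSpace 𝕜 p m q r →L[𝕜] StateSpace 𝕜 p m q r,
        ∀ f, IsSolutionAt B t f (L f) := by
    intro n
    induction n with
    | zero =>
      intro t h0 h1
      exact ⟨stepOp B t, isSolutionAt_stepOp h0 (by simpa using h1)⟩
    | succ n ih =>
      intro t h0 h1
      rcases le_total t 1 with h | h
      · exact ⟨stepOp B t, isSolutionAt_stepOp h0 h⟩
      · push_cast at h1
        obtain ⟨L, hL⟩ := ih (t - 1) (by linarith) (by linarith)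
        refine ⟨(stepOp B 1).comp L, fun f => ?_⟩
        have := (hL f).trans zero_le_one (by linarith)
          (isSolutionAt_stepOp zero_le_one le_rfl (L f))
        rwa [add_sub_cancel] at this
  obtain ⟨n, hn⟩ := exists_nat_ge t
  exact key n t ht (by linarith)

lemma isExplicitFamily_iff
    {T : ℝ≥0 → StateSpace 𝕜 p m q r →L[𝕜] StateSpace 𝕜 p m q r} :
    IsExplicitFamily B T ↔ ∀ (t : ℝ≥0) f, IsSolutionAt B t f (T t f) := by
  simp only [isSolutionAt_iff]
  rfl

theorem IsExplicitFamily.unique {S T : ℝ≥0 → StateSpace 𝕜 p m q r →L[𝕜] StateSpace 𝕜 p m q r}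
    (hS : IsExplicitFamily B S) (hT : IsExplicitFamily B T) : S = T :=
  funext fun t => ContinuousLinearMap.ext fun f =>
    (isExplicitFamily_iff.1 hS t f).unique (isExplicitFamily_iff.1 hT t f)

variable (p B) in
theorem exists_isExplicitFamily :
    ∃ T : ℝ≥0 → StateSpace 𝕜 p m q r →L[𝕜] StateSpace 𝕜 p m q r, IsExplicitFamily B T := by
  choose T hT using fun t : ℝ≥0 => exists_solutionOp (B := B) (p := p) t.coe_nonneg
  exact ⟨T, isExplicitFamily_iff.2 hT⟩

/-- The solution operators form a strongly continuous semigroup of exponential growth. The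
semigroup law is uniqueness of solutions together with `IsSolutionAt.trans`. -/
theorem IsExplicitFamily.isC0Semigroup (hp : p ≠ ⊤)
    {T : ℝ≥0 → StateSpace 𝕜 p m q r →L[𝕜] StateSpace 𝕜 p m q r} (hT : IsExplicitFamily B T) :
    IsC0Semigroup T ∧ ∃ M b : ℝ, 0 ≤ M ∧ ∀ t : ℝ≥0, ‖T t‖ ≤ M * Real.exp (b * t) := by
  have hs := isExplicitFamily_iff.1 hT
  have hstep : ∀ t : ℝ≥0, t ≤ 1 → T t = stepOp B t := fun t ht =>
    ContinuousLinearMap.ext fun f =>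
      (hs t f).unique (isSolutionAt_stepOp t.coe_nonneg (by exact_mod_cast ht) f)
  have h0 : T 0 = ContinuousLinearMap.id 𝕜 _ := by
    refine ContinuousLinearMap.ext fun f => (hs 0 f).unique ⟨?_, ?_, ?_⟩
    · refine Eventually.of_forall fun y hy _ => ?_
      rw [NNReal.coe_zero, sub_zero, stateU_of_nonneg _ hy.le]
      rfl
    · refine Eventually.of_forall fun y hy => ?_
      rw [NNReal.coe_zero, sub_zero, stateV_of_pos _ hy]
      rfl
    · refine Eventually.of_forall fun y hy => ?_
      rw [NNReal.coe_zero, add_zero]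
      rfl
  have hadd : ∀ s t : ℝ≥0, T (s + t) = (T s).comp (T t) := fun s t =>
    ContinuousLinearMap.ext fun f =>
      (hs (s + t) f).unique ((hs t f).trans s.coe_nonneg t.coe_nonneg (hs s (T t f)))
  have hbd : ∃ K, ∀ t : Icc (0 : ℝ) 1, ‖stepOp (p := p) B t‖ ≤ K := by
    refine banach_steinhaus fun f => ?_
    obtain ⟨C, hC⟩ := isCompact_Icc.exists_bound_of_continuousOn
      (continuous_stepOp B hp f).continuousOn (s := Icc (0 : ℝ) 1)
    exact ⟨C, fun t => hC t t.2⟩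
  obtain ⟨K, hK⟩ := hbd
  obtain ⟨M, b, hM0, hM⟩ := exists_exp_bound h0 hadd (K := K) fun t ht => by
    rw [hstep t ht]
    exact hK ⟨t, t.coe_nonneg, by exact_mod_cast ht⟩
  refine ⟨IsC0Semigroup.of_tendsto_zero h0 hadd hM0 hM fun f => ?_, M, b, hM0, hM⟩
  have hlim : Tendsto (fun t : ℝ≥0 => stepOp B t f) (𝓝 0) (𝓝 (stepOp B (0 : ℝ≥0) f)) :=
    ((continuous_stepOp B hp f).comp NNReal.continuous_coe).tendsto 0
  rw [← hstep 0 zero_le_one, h0] at hlim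
  refine hlim.congr' ?_
  filter_upwards [Iic_mem_nhds (zero_lt_one : (0 : ℝ≥0) < 1)] with t ht
  rw [hstep t ht]

end Step

/-! ### Weak derivatives on an interval -/

section WeakDeriv

variable {𝕜 : Type*} [RCLike 𝕜]

lemma setIntegral_smul_eq_integral {s : Set ℝ} {φ : ℝ → ℝ} (h : tsupport φ ⊆ s) (f : ℝ → 𝕜) :
    ∫ x in s, φ x • f x = ∫ x, φ x • f x :=
  setIntegral_eq_integral_of_forall_compl_eq_zero fun x hx => by
    rw [image_eq_zero_of_notMem_tsupport fun h' => hx (h h'), zero_smul]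

/-- Integration by parts against a primitive, by Fubini's theorem. -/
lemma integral_deriv_smul_integral_Iio {g : ℝ → 𝕜} (hg : Integrable g) {φ : ℝ → ℝ}
    (hφ : ContDiff ℝ ∞ φ) (hc : HasCompactSupport φ) :
    ∫ x, deriv φ x • ∫ y in Iio x, g y = -∫ x, φ x • g x := by
  have hφ1 : ContDiff ℝ 1 φ := hφ.of_le (by exact_mod_cast le_top)
  have hd : Integrable (deriv φ) :=
    (hφ1.continuous_deriv le_rfl).integrable_of_hasCompactSupport hc.deriv
  have hmeas : MeasurableSet {z : ℝ × ℝ | z.2 < z.1} :=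
    measurableSet_lt measurable_snd measurable_fst
  have hI : Integrable ({z : ℝ × ℝ | z.2 < z.1}.indicator fun z => deriv φ z.1 • g z.2)
      (volume.prod volume) := (hd.smul_prod hg).indicator hmeas
  have e1 : ∀ x : ℝ, deriv φ x • ∫ y in Iio x, g y =
      ∫ y, {z : ℝ × ℝ | z.2 < z.1}.indicator (fun z => deriv φ z.1 • g z.2) (x, y) := by
    intro x
    rw [← integral_smul, ← integral_indicator measurableSet_Iio]
    rfl
  have e2 : ∀ y : ℝ, ∫ x, {z : ℝ × ℝ | z.2 < z.1}.indicator
      (fun z => deriv φ z.1 • g z.2) (x, y) = -(φ y • g y) := by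
    intro y
    have : ∫ x in Ioi y, deriv φ x • g y = -(φ y • g y) := by
      rw [integral_smul_const, HasCompactSupport.integral_Ioi_deriv_eq hφ1 hc, neg_smul]
    rw [← this, ← integral_indicator measurableSet_Ioi]
    rfl
  simp only [e1]
  rw [integral_integral_swap (f := fun x y =>
    {z : ℝ × ℝ | z.2 < z.1}.indicator (fun z => deriv φ z.1 • g z.2) (x, y)) hI]
  simp only [e2]
  exact integral_neg _

lemma integral_deriv_eq_zero {φ : ℝ → ℝ} (hφ : ContDiff ℝ ∞ φ) (hc : HasCompactSupport φ) :
    ∫ x, deriv φ x = 0 := by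
  have hφ1 : ContDiff ℝ 1 φ := hφ.of_le (by exact_mod_cast le_top)
  have hd : Integrable (deriv φ) :=
    (hφ1.continuous_deriv le_rfl).integrable_of_hasCompactSupport hc.deriv
  rw [← intervalIntegral.integral_Iic_add_Ioi (b := 0) hd.integrableOn hd.integrableOn,
    HasCompactSupport.integral_Ioi_deriv_eq hφ1 hc, HasCompactSupport.integral_Iic_deriv_eq hφ1 hc,
    add_neg_cancel]

lemma continuous_integral_Iio {g : ℝ → 𝕜} (hg : ∀ R, IntegrableOn g (Iio R)) :
    Continuous fun x => ∫ y in Iio x, g y := by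
  have hg' : ∀ R, IntegrableOn g (Iic R) := fun R =>
    (hg (R + 1)).mono_set (Iic_subset_Iio.2 (lt_add_one R))
  have e : ∀ x, ∫ y in Iio x, g y = (∫ y in Iic (0 : ℝ), g y) + ∫ y in (0 : ℝ)..x, g y := by
    intro x
    rw [← integral_Iic_eq_integral_Iio, ← intervalIntegral.integral_Iic_sub_Iic (hg' 0) (hg' x)]
    abel
  simp only [e]
  refine continuous_const.add (intervalIntegral.continuous_primitive (fun a b => ?_) 0)
  rw [intervalIntegrable_iff]
  exact (hg' (max a b)).mono_set fun x hx => hx.2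

lemma continuous_integral_Ioi {g : ℝ → 𝕜} (hg : Integrable g) :
    Continuous fun x => ∫ y in Ioi x, g y := by
  have e : ∀ x, ∫ y in Ioi x, g y = (∫ y, g y) - ∫ y in Iio x, g y := fun x => by
    rw [← integral_Iic_eq_integral_Iio, eq_sub_iff_add_eq',
      intervalIntegral.integral_Iic_add_Ioi hg.integrableOn hg.integrableOn]
  simp only [e]
  exact continuous_const.sub (continuous_integral_Iio fun R => hg.integrableOn)

lemma hasWeakDerivOn_integral_Iio (s : Set ℝ) {g : ℝ → 𝕜}
    (hg : ∀ R, IntegrableOn g (Iio R)) : HasWeakDerivOn s (fun x => ∫ y in Iio x, g y) g := by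
  intro φ h1 h2 h3
  have h3' : tsupport (deriv φ) ⊆ s := (tsupport_deriv_subset).trans h3
  rw [setIntegral_smul_eq_integral h3', setIntegral_smul_eq_integral h3]
  obtain ⟨R, hR⟩ := h2.isCompact.bddAbove
  have e := integral_deriv_smul_integral_Iio
    ((integrable_indicator_iff measurableSet_Iio).2 (hg (R + 1))) h1 h2
  have e1 : ∀ x, deriv φ x • ∫ y in Iio x, (Iio (R + 1)).indicator g y =
      deriv φ x • ∫ y in Iio x, g y := by
    intro x
    by_cases hx : x ∈ tsupport φ
    · have hxR : x ≤ R := hR hx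
      congr 1
      refine setIntegral_congr_fun measurableSet_Iio fun y hy => indicator_of_mem ?_ _
      have : y < x := hy
      exact mem_Iio.2 (by linarith)
    · rw [image_eq_zero_of_notMem_tsupport fun h' => hx (tsupport_deriv_subset h'), zero_smul,
        zero_smul]
  have e2 : ∀ x, φ x • (Iio (R + 1)).indicator g x = φ x • g x := by
    intro x
    by_cases hx : x ∈ tsupport φ
    · have hxR : x ≤ R := hR hx
      rw [indicator_of_mem (mem_Iio.2 (by linarith))]
    · rw [image_eq_zero_of_notMem_tsupport hx, zero_smul, zero_smul]
  simpa only [e1, e2] using e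

lemma hasWeakDerivOn_integral_Ioi (s : Set ℝ) {g : ℝ → 𝕜} (hg : Integrable g) :
    HasWeakDerivOn s (fun x => ∫ y in Ioi x, g y) (fun x => -g x) := by
  intro φ h1 h2 h3
  have e := hasWeakDerivOn_integral_Iio s (fun R => hg.integrableOn) φ h1 h2 h3
  have h3' : tsupport (deriv φ) ⊆ s := (tsupport_deriv_subset).trans h3
  rw [setIntegral_smul_eq_integral h3'] at e ⊢
  have hφ1 : ContDiff ℝ 1 φ := h1.of_le (by exact_mod_cast le_top)
  have hd : Integrable (deriv φ) :=
    (hφ1.continuous_deriv le_rfl).integrable_of_hasCompactSupport h2.deriv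
  have e1 : ∀ x, ∫ y in Ioi x, g y = (∫ y, g y) - ∫ y in Iio x, g y := fun x => by
    rw [← integral_Iic_eq_integral_Iio, eq_sub_iff_add_eq',
      intervalIntegral.integral_Iic_add_Ioi hg.integrableOn hg.integrableOn]
  have hi : Integrable fun x => deriv φ x • ∫ y in Iio x, g y :=
    (continuous_integral_Iio fun R => hg.integrableOn).locallyIntegrable
      |>.integrable_smul_left_of_hasCompactSupport (hφ1.continuous_deriv le_rfl) h2.deriv
  simp only [e1, smul_sub, smul_neg]
  rw [integral_sub (hd.smul_const _) hi, integral_smul_const, integral_deriv_eq_zero h1 h2,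
    zero_smul, zero_sub, e, integral_neg]

/-- Leibniz rule for multiplication with an exponential. -/
lemma hasWeakDerivOn_exp_smul_iff {s : Set ℝ} {f h : ℝ → 𝕜}
    (hf : LocallyIntegrable f (volume.restrict s)) (hh : LocallyIntegrable h (volume.restrict s))
    (l : ℝ) :
    HasWeakDerivOn s (fun x => Real.exp (l * x) • f x) (fun x => Real.exp (l * x) • h x) ↔
      HasWeakDerivOn s f (fun x => h x - l • f x) := by
  have hder : ∀ (a : ℝ) {φ : ℝ → ℝ}, ContDiff ℝ ∞ φ → ∀ x,
      deriv (fun x => Real.exp (a * x) * φ x) x = Real.exp (a * x) * (deriv φ x + a * φ x) := by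
    intro a φ hφ x
    have e1 : HasDerivAt (fun x => Real.exp (a * x)) (Real.exp (a * x) * a) x := by
      simpa using ((hasDerivAt_id x).const_mul a).exp
    have e2 := (hφ.differentiable (by simp) x).hasDerivAt
    rw [(e1.fun_mul e2).deriv]
    ring
  have hsm : ∀ (a : ℝ) {φ : ℝ → ℝ}, ContDiff ℝ ∞ φ →
      ContDiff ℝ ∞ (fun x => Real.exp (a * x) * φ x) := fun a φ hφ =>
    (Real.contDiff_exp.comp (contDiff_const.mul contDiff_id)).mul hφ
  have hint : ∀ {k : ℝ → 𝕜}, LocallyIntegrable k (volume.restrict s) → ∀ {φ : ℝ → ℝ},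
      Continuous φ → HasCompactSupport φ → IntegrableOn (fun x => φ x • k x) s :=
    fun hk _ h1 h2 => hk.integrable_smul_left_of_hasCompactSupport h1 h2
  constructor
  · intro H φ h1 h2 h3
    have key := H _ (hsm (-l) h1) h2.mul_left ((tsupport_mul_subset_right).trans h3)
    have e1 : ∀ x, deriv (fun x => Real.exp (-l * x) * φ x) x • Real.exp (l * x) • f x =
        deriv φ x • f x - l • φ x • f x := by
      intro x
      have : Real.exp (-l * x) * Real.exp (l * x) = 1 := by
        rw [← Real.exp_add]
        simp
      rw [hder _ h1, smul_smul, smul_smul, ← sub_smul]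
      congr 1
      linear_combination (deriv φ x + -l * φ x) * this
    have e2 : ∀ x, (Real.exp (-l * x) * φ x) • Real.exp (l * x) • h x = φ x • h x := by
      intro x
      have : Real.exp (-l * x) * Real.exp (l * x) = 1 := by
        rw [← Real.exp_add]
        simp
      rw [smul_smul]
      congr 1
      linear_combination φ x * this
    simp only [e1, e2] at key
    have i1 := hint hf (h1.continuous_deriv (by simp)) h2.deriv
    have i2 := hint hf h1.continuous h2
    have i3 := hint hh h1.continuous h2
    rw [integral_sub i1 (i2.fun_smul l), integral_smul] at key
    simp only [smul_sub, smul_comm _ l]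
    rw [integral_sub i3 (i2.fun_smul l), integral_smul, eq_add_of_sub_eq key]
    abel
  · intro H φ h1 h2 h3
    have key := H _ (hsm l h1) h2.mul_left ((tsupport_mul_subset_right).trans h3)
    have hex : ContDiff ℝ ∞ fun x => Real.exp (l * x) :=
      Real.contDiff_exp.comp (contDiff_const.mul contDiff_id)
    have e1 : ∀ x, deriv (fun x => Real.exp (l * x) * φ x) x • f x =
        deriv φ x • Real.exp (l * x) • f x + l • φ x • Real.exp (l * x) • f x := by
      intro x
      rw [hder _ h1, smul_smul, smul_smul, smul_smul, ← add_smul]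
      congr 1
      ring
    have e2 : ∀ x, (Real.exp (l * x) * φ x) • (h x - l • f x) =
        φ x • Real.exp (l * x) • h x - l • φ x • Real.exp (l * x) • f x := by
      intro x
      simp only [smul_sub, smul_smul]
      congr 2
      · ring
      · ring
    have hint' : ∀ {k : ℝ → 𝕜}, LocallyIntegrable k (volume.restrict s) → ∀ {φ : ℝ → ℝ},
        Continuous φ → HasCompactSupport φ →
        IntegrableOn (fun x => φ x • Real.exp (l * x) • k x) s := by
      intro k hk φ h1 h2
      simp only [smul_smul]
      exact hint hk (h1.mul hex.continuous) h2.mul_right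
    simp only [e1, e2] at key
    have i1 := hint' hf (h1.continuous_deriv (by simp)) h2.deriv
    have i2 := hint' hf h1.continuous h2
    have i3 := hint' hh h1.continuous h2
    rw [integral_add i1 (i2.fun_smul l), integral_sub i3 (i2.fun_smul l)] at key
    rw [eq_sub_of_add_eq key]
    abel

/-- The lemma of du Bois-Reymond: on an interval, a function with weak derivative zero is
constant. -/
lemma HasWeakDerivOn.exists_ae_eq_const {s : Set ℝ} (hs : IsOpen s) (hconn : s.OrdConnected)
    (hne : s.Nonempty) {f : ℝ → 𝕜} (hf : LocallyIntegrable f (volume.restrict s))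
    (h : HasWeakDerivOn s f fun _ => 0) : ∃ c : 𝕜, f =ᵐ[volume.restrict s] fun _ => c := by
  obtain ⟨x₀, hx₀⟩ := hne
  obtain ⟨ε, hε, hball⟩ := Metric.isOpen_iff.1 hs x₀ hx₀
  let bump : ContDiffBump x₀ := ⟨ε / 4, ε / 2, by linarith, by linarith⟩
  set ψ : ℝ → ℝ := bump.normed volume with hψ
  have hψ1 : ContDiff ℝ ∞ ψ := bump.contDiff_normed
  have hψ2 : HasCompactSupport ψ := bump.hasCompactSupport_normed
  have hψ3 : tsupport ψ ⊆ s := by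
    rw [hψ, bump.tsupport_normed_eq]
    exact (Metric.closedBall_subset_ball (by change ε / 2 < ε; linarith)).trans hball
  have hψint : ∫ x, ψ x = 1 := bump.integral_normed
  -- A test function of integral zero is the derivative of a test function.
  have hzero : ∀ θ : ℝ → ℝ, ContDiff ℝ ∞ θ → HasCompactSupport θ → tsupport θ ⊆ s →
      ∫ x, θ x = 0 → ∫ x in s, θ x • f x = 0 := by
    intro θ h1 h2 h3 h4
    rcases (tsupport θ).eq_empty_or_nonempty with hemp | hK
    · rw [tsupport_eq_empty_iff] at hemp
      simp [hemp]
    obtain ⟨a, ha⟩ := h2.isCompact.exists_isLeast hK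
    obtain ⟨b, hb⟩ := h2.isCompact.exists_isGreatest hK
    set η : ℝ → ℝ := fun x => ∫ t in (a - 1)..x, θ t with hη
    have hder : ∀ x, HasDerivAt η (θ x) x := fun x =>
      intervalIntegral.integral_hasDerivAt_right (h1.continuous.intervalIntegrable _ _)
        h1.continuous.stronglyMeasurable.stronglyMeasurableAtFilter h1.continuous.continuousAt
    have hderiv : deriv η = θ := funext fun x => (hder x).deriv
    have hη1 : ContDiff ℝ ∞ η :=
      contDiff_infty_iff_deriv.2 ⟨fun x => (hder x).differentiableAt, hderiv ▸ h1⟩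
    have hout : ∀ x, x ∉ Icc a b → η x = 0 := by
      intro x hx
      rcases lt_or_ge x a with hxa | hxa
      · refine (intervalIntegral.integral_congr (g := fun _ => (0 : ℝ)) fun t ht => ?_).trans
          (by simp)
        have hta : t < a := lt_of_le_of_lt ht.2 (max_lt (by linarith) hxa)
        exact image_eq_zero_of_notMem_tsupport fun ht' => not_lt.2 (ha.2 ht') hta
      · have hxb : b < x := by
          by_contra hcon
          exact hx ⟨hxa, not_lt.1 hcon⟩
        rw [hη]
        simp only
        rw [intervalIntegral.integral_eq_integral_of_support_subset, h4]
        intro t ht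
        have ht' := subset_tsupport θ ht
        have h5 := ha.2 ht'
        have h6 := hb.2 ht'
        exact ⟨by linarith, by linarith⟩
    have hη2 : HasCompactSupport η := HasCompactSupport.intro isCompact_Icc hout
    have hη3 : tsupport η ⊆ s :=
      (closure_minimal (fun x hx => by
        by_contra hcon
        exact hx (hout x hcon)) isClosed_Icc).trans (hconn.out (h3 ha.1) (h3 hb.1))
    have := h η hη1 hη2 hη3
    rw [hderiv] at this
    simpa using this
  have hint : ∀ {φ : ℝ → ℝ}, Continuous φ → HasCompactSupport φ →
      IntegrableOn (fun x => φ x • f x) s :=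
    fun h1 h2 => hf.integrable_smul_left_of_hasCompactSupport h1 h2
  set c : 𝕜 := ∫ x in s, ψ x • f x with hc
  refine ⟨c, ?_⟩
  have hloc : LocallyIntegrable (fun x => f x - c) (volume.restrict s) :=
    hf.sub (locallyIntegrable_const c)
  have hae := hs.ae_eq_zero_of_integral_contDiff_smul_eq_zero (hloc.locallyIntegrableOn s)
    fun φ h1 h2 h3 => by
      have hφi : Integrable φ := h1.continuous.integrable_of_hasCompactSupport h2
      have hψi : Integrable ψ := hψ1.continuous.integrable_of_hasCompactSupport hψ2
      have hθ := hzero (fun x => φ x - (∫ y, φ y) * ψ x) (h1.sub (contDiff_const.mul hψ1))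
        (h2.sub hψ2.mul_left) ?_ ?_
      · have e : ∀ x, (φ x - (∫ y, φ y) * ψ x) • f x =
            φ x • f x - (∫ y, φ y) • ψ x • f x := fun x => by
          rw [sub_smul, mul_smul]
        simp only [e] at hθ
        rw [integral_sub (hint h1.continuous h2) ((hint hψ1.continuous hψ2).fun_smul _),
          integral_smul, ← hc, sub_eq_zero] at hθ
        simp only [smul_sub]
        rw [integral_sub (hint h1.continuous h2) (hφi.integrableOn.smul_const c), hθ,
          setIntegral_smul_eq_integral h3 (fun _ => c), integral_smul_const, sub_self]
      · refine (tsupport_sub _ _).trans (union_subset h3 ?_)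
        exact (tsupport_mul_subset_right).trans hψ3
      · rw [integral_sub hφi (hψi.const_mul _), integral_const_mul, hψint, mul_one, sub_self]
  filter_upwards [hae, ae_restrict_mem hs.measurableSet] with x hx hxs
  exact sub_eq_zero.1 (hx hxs)

/-- A boundary value can be read off from any representative that is continuous up to the
boundary. -/
lemma HasBoundaryValue.eq_of_ae_eq {s : Set ℝ} (hs : IsOpen s) {a : ℝ} (ha : a ∈ closure s)
    {f F : ℝ → 𝕜} {c : 𝕜} (h : HasBoundaryValue s f a c) (hF : ContinuousOn F (closure s))
    (hfF : f =ᵐ[volume.restrict s] F) : c = F a := by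
  obtain ⟨G, hG, hfG, rfl⟩ := h
  have h1 : EqOn G F s := Measure.eqOn_open_of_ae_eq (hfG.symm.trans hfF) hs
    (hG.mono subset_closure) (hF.mono subset_closure)
  exact h1.of_subset_closure hG hF subset_closure subset_rfl ha

end WeakDeriv

/-! ### Pointwise Laplace transforms -/

section PointwiseLaplace

variable {𝕜 : Type*} [RCLike 𝕜] {p : ℝ≥0∞}

lemma HasLaplace.congr {E : Type*} [NormedAddCommGroup E] [NormedSpace 𝕜 E] [NormedSpace ℝ E]
    {lam : 𝕜} {y z : ℝ → E} {c : E} (h : HasLaplace lam y c)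
    (hyz : ∀ᵐ t : ℝ, 0 < t → y t = z t) : HasLaplace lam z c := by
  have e : (fun t => expWeight lam t • y t) =ᵐ[volume.restrict (Ioi 0)]
      fun t => expWeight lam t • z t := by
    refine (ae_restrict_iff' measurableSet_Ioi).2 ?_
    filter_upwards [hyz] with t ht h0
    rw [ht h0]
  exact ⟨h.1.congr e, (integral_congr_ae e).symm.trans h.2⟩

/-- A Laplace transform in a space with an `L^p` component can be computed pointwise in that
component. -/
lemma HasLaplace.ae_component [Fact (1 ≤ p)] {X : Type*} [NormedAddCommGroup X]
    [NormedSpace 𝕜 X] [NormedSpace ℝ X] [CompleteSpace X] {s : Set ℝ}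
    (L : X →L[𝕜] Lp 𝕜 p (volume.restrict s)) {lam : 𝕜} {y : ℝ → X} {c : X}
    (h : HasLaplace lam y c) {k : ℝ → ℝ → 𝕜} (hk : Measurable (Function.uncurry k))
    (hyk : ∀ t, 0 < t → L (y t) =ᵐ[volume.restrict s] k t) :
    ∀ᵐ x ∂volume.restrict s, HasLaplace lam (fun t => k t x) (L c x) := by
  have hF : IntegrableOn (fun t => L (expWeight lam t • y t)) (Ioi 0) := L.integrable_comp h.1
  have hK : Measurable fun z : ℝ × ℝ => expWeight lam z.1 • k z.1 z.2 :=
    ((continuous_expWeight lam).measurable.comp measurable_fst).smul hk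
  have hFK : ∀ᵐ t ∂volume.restrict (Ioi (0 : ℝ)), L (expWeight lam t • y t)
      =ᵐ[volume.restrict s] fun x => expWeight lam t • k t x := by
    filter_upwards [ae_restrict_mem measurableSet_Ioi] with t ht
    rw [map_smul]
    filter_upwards [Lp.coeFn_smul (expWeight lam t) (L (y t)), hyk t ht] with x h1 h2
    rw [h1, Pi.smul_apply, h2]
  have hLc : ∫ t in Ioi (0 : ℝ), L (expWeight lam t • y t) = L c := by
    rw [L.integral_comp_comm h.1, h.2]
  filter_upwards [ae_integral_Lp_eq hF hK.aestronglyMeasurable hFK] with x hx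
  refine ⟨hx.1, ?_⟩
  rw [← hLc, hx.2]

/-- For a real parameter, the Laplace transform of a function moving to the right. -/
lemma HasLaplace.comp_sub_left {l : ℝ} {Φ : ℝ → 𝕜} {x : ℝ} {c : 𝕜}
    (h : HasLaplace (l : 𝕜) (fun t => Φ (x - t)) c) :
    IntegrableOn (fun s => Real.exp (l * s) • Φ s) (Iio x) ∧
      Real.exp (l * x) • c = ∫ s in Iio x, Real.exp (l * s) • Φ s := by
  have hmp := Measure.measurePreserving_sub_left (volume : Measure ℝ) x
  have hemb : MeasurableEmbedding fun t : ℝ => x - t :=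
    (MeasurableEquiv.subLeft x).measurableEmbedding
  have hpre : (fun t : ℝ => x - t) ⁻¹' Iio x = Ioi 0 := by
    ext t
    simp
  have e : ∀ t, Real.exp (l * (x - t)) • Φ (x - t) =
      Real.exp (l * x) • expWeight (l : 𝕜) t • Φ (x - t) := by
    intro t
    rw [expWeight_ofReal, ← RCLike.real_smul_eq_coe_smul, smul_smul, ← Real.exp_add]
    congr 2
    ring
  constructor
  · rw [← hmp.integrableOn_comp_preimage hemb, hpre]
    simp only [Function.comp_def, e]
    exact Integrable.fun_smul (Real.exp (l * x)) h.1
  · rw [← hmp.setIntegral_preimage_emb hemb, hpre]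
    simp only [e]
    rw [integral_smul, h.2]

/-- For a real parameter, the Laplace transform of a function moving to the left. -/
lemma HasLaplace.comp_add {l : ℝ} {Φ : ℝ → 𝕜} {x : ℝ} {c : 𝕜}
    (h : HasLaplace (l : 𝕜) (fun t => Φ (x + t)) c) :
    IntegrableOn (fun s => Real.exp (-l * s) • Φ s) (Ioi x) ∧
      Real.exp (-l * x) • c = ∫ s in Ioi x, Real.exp (-l * s) • Φ s := by
  have hmp := measurePreserving_add_left (volume : Measure ℝ) x
  have hemb : MeasurableEmbedding fun t : ℝ => x + t := measurableEmbedding_addLeft x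
  have hpre : (fun t : ℝ => x + t) ⁻¹' Ioi x = Ioi 0 := by
    ext t
    simp
  have e : ∀ t, Real.exp (-l * (x + t)) • Φ (x + t) =
      Real.exp (-l * x) • expWeight (l : 𝕜) t • Φ (x + t) := by
    intro t
    rw [expWeight_ofReal, ← RCLike.real_smul_eq_coe_smul, smul_smul, ← Real.exp_add]
    congr 2
    ring
  constructor
  · rw [← hmp.integrableOn_comp_preimage hemb, hpre]
    simp only [Function.comp_def, e]
    exact Integrable.fun_smul (Real.exp (-l * x)) h.1
  · rw [← hmp.setIntegral_preimage_emb hemb, hpre]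
    simp only [e]
    rw [integral_smul, h.2]

end PointwiseLaplace

section Components

variable {𝕜 : Type*} [RCLike 𝕜] {p : ℝ≥0∞} [Fact (1 ≤ p)] {m q r : ℕ}
  {B : Matrix (Fin m ⊕ Fin q) (Fin m ⊕ Fin r) 𝕜}
  {T : ℝ≥0 → StateSpace 𝕜 p m q r →L[𝕜] StateSpace 𝕜 p m q r}

/-- The Laplace transform of the solution in the state space is, almost everywhere, the Laplace
transform of the shifted extended data. -/
lemma IsExplicitFamily.ae_hasLaplace_state (hT : IsExplicitFamily B T) {lam : 𝕜}
    {f c : StateSpace 𝕜 p m q r} (h : HasLaplace lam (fun t : ℝ => T t.toNNReal f) c) :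
    (∀ j, ∀ᵐ x ∂muB, HasLaplace lam (fun t : ℝ => stateU B f (x - t) j) (c.1 j x)) ∧
    (∀ j, ∀ᵐ x ∂muU, HasLaplace lam (fun t : ℝ => stateV B f (x - t) j) (c.2.1 j x)) ∧
    (∀ j, ∀ᵐ x ∂muU, HasLaplace lam (fun t : ℝ => wFun f (x + t) j) (c.2.2 j x)) := by
  have hs := isExplicitFamily_iff.1 hT
  have hsub : Measurable fun z : ℝ × ℝ => z.2 - z.1 := measurable_snd.sub measurable_fst
  have hadd : Measurable fun z : ℝ × ℝ => z.2 + z.1 := measurable_snd.add measurable_fst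
  refine ⟨fun j => ?_, fun j => ?_, fun j => ?_⟩
  · refine h.ae_component ((ContinuousLinearMap.proj (R := 𝕜) (φ := fun _ : Fin m => Lp 𝕜 p muB)
      j).comp (ContinuousLinearMap.fst 𝕜 _ _)) (k := fun t x => stateU B f (x - t) j)
      ((measurable_pi_apply j).comp ((measurable_stateU f).comp hsub)) fun t ht => ?_
    refine (ae_restrict_iff' measurableSet_Ioo).2 ?_
    filter_upwards [(hs t.toNNReal f).u] with y hy h0
    have := congrFun (hy h0.1 h0.2) j
    rwa [Real.coe_toNNReal t ht.le] at this
  · refine h.ae_component ((ContinuousLinearMap.proj (R := 𝕜) (φ := fun _ : Fin q => Lp 𝕜 p muU)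
      j).comp ((ContinuousLinearMap.fst 𝕜 _ _).comp (ContinuousLinearMap.snd 𝕜 _ _)))
      (k := fun t x => stateV B f (x - t) j)
      ((measurable_pi_apply j).comp ((measurable_stateV f).comp hsub)) fun t ht => ?_
    refine (ae_restrict_iff' measurableSet_Ioi).2 ?_
    filter_upwards [(hs t.toNNReal f).v] with y hy h0
    have := congrFun (hy h0) j
    rwa [Real.coe_toNNReal t ht.le] at this
  · refine h.ae_component ((ContinuousLinearMap.proj (R := 𝕜) (φ := fun _ : Fin r => Lp 𝕜 p muU)
      j).comp ((ContinuousLinearMap.snd 𝕜 _ _).comp (ContinuousLinearMap.snd 𝕜 _ _)))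
      (k := fun t x => wFun f (x + t) j)
      ((measurable_pi_apply j).comp ((measurable_wFun f).comp hadd)) fun t ht => ?_
    refine (ae_restrict_iff' measurableSet_Ioi).2 ?_
    filter_upwards [(hs t.toNNReal f).w] with y hy h0
    have := congrFun (hy h0) j
    rwa [Real.coe_toNNReal t ht.le] at this

lemma IsExplicitFamily.ae_hasLaplace_formula (hT : IsExplicitFamily B T) {lam : 𝕜}
    {f c : StateSpace 𝕜 p m q r} (h : HasLaplace lam (fun t : ℝ => T t.toNNReal f) c) :
    (∀ j, ∀ᵐ x ∂muB, HasLaplace lam (fun t : ℝ => formulaU B f t x j) (c.1 j x)) ∧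
    (∀ j, ∀ᵐ x ∂muU, HasLaplace lam (fun t : ℝ => formulaV B f t x j) (c.2.1 j x)) ∧
    (∀ j, ∀ᵐ x ∂muU, HasLaplace lam (fun t : ℝ => formulaW f t x j) (c.2.2 j x)) := by
  obtain ⟨hu, hv, hw⟩ := hT.ae_hasLaplace_state h
  refine ⟨fun j => ?_, fun j => ?_, hw⟩
  · filter_upwards [hu j] with x hx
    simpa only [formulaU, solU_eq_extU] using hx
  · filter_upwards [hv j] with x hx
    refine hx.congr ?_
    filter_upwards [ae_comp_sub_left ae_ne_intCast x] with t ht _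
    rw [formulaV, solV_eq_extV _ _ _ ht]

end Components

/-! ### Laplace transforms lie in the domain of the transport operator -/

section Domain

variable {𝕜 : Type*} [RCLike 𝕜] {p : ℝ≥0∞} [Fact (1 ≤ p)]

lemma integrableOn_Ioo_exp_smul {s : Set ℝ} (hs : Ioo (0 : ℝ) 1 ⊆ s) (l : ℝ)
    (f : Lp 𝕜 p (volume.restrict s)) :
    IntegrableOn (fun x => Real.exp (l * x) • f x) (Ioo 0 1) := by
  have h1 : LocallyIntegrable (fun x => Real.exp (l * x) • f x) (volume.restrict s) :=
    ((Lp.memLp f).locallyIntegrable Fact.out).continuous_smul (by fun_prop)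
  have h2 := (h1.integrableOn_isCompact (isCompact_Icc (a := (0 : ℝ)) (b := 1))).mono_set
    Ioo_subset_Icc_self
  rwa [IntegrableOn, Measure.restrict_restrict measurableSet_Ioo, inter_eq_left.2 hs] at h2

lemma exists_mem_Ioo_of_ae {s : Set ℝ} {P : ℝ → Prop} (h : ∀ᵐ x ∂volume.restrict s, P x)
    {a b : ℝ} (hab : a < b) (hs : Ioo a b ⊆ s) : ∃ x ∈ Ioo a b, P x := by
  have h' : ∀ᵐ x ∂volume.restrict (Ioo a b), x ∈ Ioo a b ∧ P x :=
    (ae_restrict_mem measurableSet_Ioo).and (ae_restrict_of_ae_restrict_of_subset hs h)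
  have : NeBot (ae (volume.restrict (Ioo a b))) := by
    rw [ae_neBot, Ne, Measure.restrict_eq_zero, Real.volume_Ioo]
    simpa using hab
  exact h'.exists

lemma integral_Iio_zero_shift (l : ℝ) (G : ℝ → 𝕜)
    (hG : IntegrableOn (fun s => Real.exp (l * s) • G s) (Iio 1)) :
    IntegrableOn (fun s => Real.exp (l * s) • G (s + 1)) (Iio 0) ∧
      ∫ s in Iio (0 : ℝ), Real.exp (l * s) • G (s + 1) =
        Real.exp (-l) • ∫ s in Iio (1 : ℝ), Real.exp (l * s) • G s := by
  have hmp := measurePreserving_add_right (volume : Measure ℝ) 1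
  have hemb : MeasurableEmbedding fun t : ℝ => t + 1 := measurableEmbedding_addRight 1
  have hpre : (fun t : ℝ => t + 1) ⁻¹' Iio 1 = Iio 0 := by
    ext t
    simp
  have e : ∀ s, Real.exp (l * s) • G (s + 1) =
      Real.exp (-l) • Real.exp (l * (s + 1)) • G (s + 1) := by
    intro s
    rw [smul_smul, ← Real.exp_add]
    congr 2
    ring
  rw [← hmp.integrableOn_comp_preimage hemb, hpre] at hG
  rw [← hmp.setIntegral_preimage_emb hemb _ (Iio 1), hpre, ← integral_smul]
  simp only [e]
  exact ⟨Integrable.fun_smul (Real.exp (-l)) hG, trivial⟩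

lemma integral_Iio_zero_reflect (l : ℝ) (W : ℝ → 𝕜)
    (hW : IntegrableOn (fun s => Real.exp (-l * s) • W s) (Ioi 0)) :
    IntegrableOn (fun s => Real.exp (l * s) • W (-s)) (Iio 0) ∧
      ∫ s in Iio (0 : ℝ), Real.exp (l * s) • W (-s) =
        ∫ s in Ioi (0 : ℝ), Real.exp (-l * s) • W s := by
  have hmp := Measure.measurePreserving_neg (volume : Measure ℝ)
  have hemb : MeasurableEmbedding fun t : ℝ => -t := (MeasurableEquiv.neg ℝ).measurableEmbedding
  have hpre : (fun t : ℝ => -t) ⁻¹' Ioi 0 = Iio 0 := by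
    ext t
    simp
  have e : ∀ s, Real.exp (l * s) • W (-s) = Real.exp (-l * -s) • W (-s) := by
    intro s
    rw [neg_mul_neg]
  rw [← hmp.integrableOn_comp_preimage hemb, hpre] at hW
  rw [← hmp.setIntegral_preimage_emb hemb _ (Ioi 0), hpre]
  simp only [e]
  exact ⟨hW, trivial⟩

/-- The Laplace transform of the recursion `Y s = M G(s + 1) + N W(-s)`. -/
lemma integral_Iio_zero_recursion {a m r : ℕ} {M : Matrix (Fin a) (Fin m) 𝕜}
    {N : Matrix (Fin a) (Fin r) 𝕜} {Y : ℝ → Fin a → 𝕜} {G : ℝ → Fin m → 𝕜} {W : ℝ → Fin r → 𝕜}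
    (hY : ∀ s < 0, Y s = M *ᵥ G (s + 1) + N *ᵥ W (-s)) {l : ℝ}
    (hG : ∀ k, IntegrableOn (fun s => Real.exp (l * s) • G s k) (Iio 1))
    (hW : ∀ k, IntegrableOn (fun s => Real.exp (-l * s) • W s k) (Ioi 0)) :
    (fun j => ∫ s in Iio (0 : ℝ), Real.exp (l * s) • Y s j) =
      M *ᵥ (fun k => Real.exp (-l) • ∫ s in Iio (1 : ℝ), Real.exp (l * s) • G s k) +
      N *ᵥ (fun k => ∫ s in Ioi (0 : ℝ), Real.exp (-l * s) • W s k) := by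
  ext j
  have hG' := fun k => integral_Iio_zero_shift l (fun s => G s k) (hG k)
  have hW' := fun k => integral_Iio_zero_reflect l (fun s => W s k) (hW k)
  have e : ∀ s ∈ Iio (0 : ℝ), Real.exp (l * s) • Y s j =
      (∑ k, M j k * Real.exp (l * s) • G (s + 1) k) +
        ∑ k, N j k * Real.exp (l * s) • W (-s) k := by
    intro s hs
    rw [hY s hs]
    simp only [Pi.add_apply, Matrix.mulVec, dotProduct, smul_add, Finset.smul_sum,
      mul_smul_comm]
  rw [setIntegral_congr_fun measurableSet_Iio e, integral_add
    (integrable_finsetSum _ fun k _ => (hG' k).1.const_mul _)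
    (integrable_finsetSum _ fun k _ => (hW' k).1.const_mul _),
    integral_finsetSum _ fun k _ => (hG' k).1.const_mul _,
    integral_finsetSum _ fun k _ => (hW' k).1.const_mul _]
  simp only [integral_const_mul, Pi.add_apply, Matrix.mulVec, dotProduct]
  simp only [(hG' _).2, (hW' _).2]

lemma hasBoundaryValue_of_exp_smul {s : Set ℝ} {f P : ℝ → 𝕜} {l : ℝ} (hP : Continuous P)
    (h : ∀ᵐ x ∂volume.restrict s, Real.exp (l * x) • f x = P x) (a : ℝ) :
    HasBoundaryValue s f a (Real.exp (-l * a) • P a) := by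
  refine ⟨fun x => Real.exp (-l * x) • P x, Continuous.continuousOn (by fun_prop), ?_, rfl⟩
  filter_upwards [h] with x hx
  rw [← hx, smul_smul, ← Real.exp_add]
  simp

lemma hasWeakDerivOn_of_exp_smul {s : Set ℝ}
    (f h : Lp 𝕜 p (volume.restrict s)) {P g : ℝ → 𝕜} {l : ℝ}
    (hP : ∀ᵐ x ∂volume.restrict s, Real.exp (l * x) • f x = P x)
    (hPg : HasWeakDerivOn s P g) (hg : ∀ᵐ x ∂volume.restrict s, g x = Real.exp (l * x) • h x) :
    HasWeakDerivOn s f fun x => h x - l • f x :=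
  (hasWeakDerivOn_exp_smul_iff ((Lp.memLp f).locallyIntegrable Fact.out)
    ((Lp.memLp h).locallyIntegrable Fact.out) l).1
    (hPg.congr (hP.mono fun _ hx => hx.symm) hg)

variable {m q r : ℕ} {B : Matrix (Fin m ⊕ Fin q) (Fin m ⊕ Fin r) 𝕜}
  {T : ℝ≥0 → StateSpace 𝕜 p m q r →L[𝕜] StateSpace 𝕜 p m q r}

/-- For real `l`, the Laplace transform `c` of the orbit of `h` lies in the domain of the transport
operator. Its components are `e^{-lx} ∫_{-∞}^x e^{ls} U(s) ds`, with the extended data `U` of `h`,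
on the edges where the motion is to the right, and `e^{lx} ∫_x^∞ e^{-ls} w(s) ds` on the others. The
boundary condition is the Laplace transform of the recursion satisfied by the extended data. -/
theorem IsExplicitFamily.isTransportPair_laplace (hT : IsExplicitFamily B T) {l : ℝ}
    {h c : StateSpace 𝕜 p m q r} (hc : HasLaplace (l : 𝕜) (fun t : ℝ => T t.toNNReal h) c) :
    IsTransportPair B c ((l : 𝕜) • c - h) := by
  obtain ⟨hu, hv, hw⟩ := hT.ae_hasLaplace_state hc
  replace hu := fun j => (hu j).mono fun x hx =>
    HasLaplace.comp_sub_left (Φ := fun y => stateU B h y j) hx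
  replace hv := fun j => (hv j).mono fun x hx =>
    HasLaplace.comp_sub_left (Φ := fun y => stateV B h y j) hx
  replace hw := fun j => (hw j).mono fun x hx =>
    HasLaplace.comp_add (Φ := fun y => wFun h y j) hx
  -- Integrability of the weighted extended data.
  have hUi : ∀ j, IntegrableOn (fun s => Real.exp (l * s) • stateU B h s j) (Iio 1) := by
    intro j
    obtain ⟨x, hx, hxi, -⟩ := exists_mem_Ioo_of_ae (hu j) one_pos subset_rfl
    have h1 : IntegrableOn (fun s => Real.exp (l * s) • stateU B h s j) (Ioo 0 1) := by
      refine (integrableOn_Ioo_exp_smul subset_rfl l (h.1 j)).congr_fun (fun y hy => ?_)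
        measurableSet_Ioo
      simp only
      rw [stateU_of_nonneg _ hy.1.le]
      rfl
    refine (hxi.union h1).mono_set fun y hy => ?_
    rcases lt_or_ge y x with hyx | hyx
    · exact Or.inl hyx
    · exact Or.inr ⟨hx.1.trans_le hyx, hy⟩
  have hVi : ∀ j R, IntegrableOn (fun s => Real.exp (l * s) • stateV B h s j) (Iio R) := by
    intro j R
    obtain ⟨x, hx, hxi, -⟩ := exists_mem_Ioo_of_ae (hv j)
      (show max R 0 < max R 0 + 1 by linarith) fun y hy => (le_max_right R 0).trans_lt hy.1
    exact hxi.mono_set (Iio_subset_Iio ((le_max_left R 0).trans hx.1.le))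
  have hWi : ∀ j, IntegrableOn (fun s => Real.exp (-l * s) • wFun h s j) (Ioi 0) := by
    intro j
    obtain ⟨x, hx, hxi, -⟩ := exists_mem_Ioo_of_ae (hw j) one_pos Ioo_subset_Ioi_self
    have h1 : IntegrableOn (fun s => Real.exp (-l * s) • wFun h s j) (Ioo 0 1) :=
      integrableOn_Ioo_exp_smul Ioo_subset_Ioi_self (-l) (h.2.2 j)
    refine (hxi.union h1).mono_set fun y hy => ?_
    rcases lt_or_ge x y with hyx | hyx
    · exact Or.inl hyx
    · exact Or.inr ⟨hy, hyx.trans_lt hx.2⟩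
  -- Primitives of the weighted extended data, continuous on the whole line.
  set gU : Fin m → ℝ → 𝕜 := fun j =>
    (Iio (1 : ℝ)).indicator fun s => Real.exp (l * s) • stateU B h s j with hgU
  have hgUi : ∀ j, Integrable (gU j) := fun j =>
    (integrable_indicator_iff measurableSet_Iio).2 (hUi j)
  set gV : Fin q → ℝ → 𝕜 := fun j s => Real.exp (l * s) • stateV B h s j with hgV
  set gW : Fin r → ℝ → 𝕜 := fun j =>
    (Ioi (0 : ℝ)).indicator fun s => Real.exp (-l * s) • wFun h s j with hgW
  have hgWi : ∀ j, Integrable (gW j) := fun j =>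
    (integrable_indicator_iff measurableSet_Ioi).2 (hWi j)
  have hPU : ∀ j x, x ≤ 1 → ∫ s in Iio x, gU j s =
      ∫ s in Iio x, Real.exp (l * s) • stateU B h s j := fun j x hx =>
    setIntegral_congr_fun measurableSet_Iio fun s hs =>
      indicator_of_mem (show s ∈ Iio (1 : ℝ) from lt_of_lt_of_le hs hx) _
  have hPW : ∀ j x, 0 ≤ x → ∫ s in Ioi x, gW j s =
      ∫ s in Ioi x, Real.exp (-l * s) • wFun h s j := fun j x hx =>
    setIntegral_congr_fun measurableSet_Ioi fun s hs =>
      indicator_of_mem (show s ∈ Ioi (0 : ℝ) from lt_of_le_of_lt hx hs) _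
  have hcU : ∀ j, ∀ᵐ x ∂muB, Real.exp (l * x) • c.1 j x = ∫ s in Iio x, gU j s := fun j => by
    filter_upwards [hu j, ae_restrict_mem measurableSet_Ioo] with x hx hx1
    rw [hPU j x hx1.2.le, hx.2]
  have hcV : ∀ j, ∀ᵐ x ∂muU, Real.exp (l * x) • c.2.1 j x = ∫ s in Iio x, gV j s := fun j =>
    (hv j).mono fun x hx => hx.2
  have hcW : ∀ j, ∀ᵐ x ∂muU, Real.exp (-l * x) • c.2.2 j x = ∫ s in Ioi x, gW j s := fun j => by
    filter_upwards [hw j, ae_restrict_mem measurableSet_Ioi] with x hx hx1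
    rw [hPW j x (le_of_lt hx1), hx.2]
  have hcontU := fun j => continuous_integral_Iio fun R => (hgUi j).integrableOn (s := Iio R)
  have hcontV := fun j => continuous_integral_Iio (hVi j)
  have hcontW := fun j => continuous_integral_Ioi (hgWi j)
  refine ⟨fun j => ?_, fun j => ?_, fun j => ?_, fun j => Real.exp (-l * 0) • ∫ s in Iio 0, gU j s,
    fun j => Real.exp (-l * 1) • ∫ s in Iio 1, gU j s,
    fun j => Real.exp (-l * 0) • ∫ s in Iio 0, gV j s,
    fun j => Real.exp (- -l * 0) • ∫ s in Ioi 0, gW j s,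
    fun j => hasBoundaryValue_of_exp_smul (hcontU j) (hcU j) 0,
    fun j => hasBoundaryValue_of_exp_smul (hcontU j) (hcU j) 1,
    fun j => hasBoundaryValue_of_exp_smul (hcontV j) (hcV j) 0,
    fun j => hasBoundaryValue_of_exp_smul (hcontW j) (hcW j) 0, ?_⟩
  · have := hasWeakDerivOn_of_exp_smul (c.1 j) (h.1 j) (hcU j)
      (hasWeakDerivOn_integral_Iio _ fun R => (hgUi j).integrableOn) (by
        filter_upwards [ae_restrict_mem measurableSet_Ioo] with x hx
        rw [hgU]
        simp only
        rw [indicator_of_mem (show x ∈ Iio (1 : ℝ) from hx.2), stateU_of_nonneg _ hx.1.le]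
        rfl)
    refine this.congr (ae_eq_refl _) ?_
    change _ =ᵐ[muB] (-((l : 𝕜) • c.1 j - h.1 j) : Lp 𝕜 p muB)
    filter_upwards [Lp.coeFn_neg ((l : 𝕜) • c.1 j - h.1 j), Lp.coeFn_sub ((l : 𝕜) • c.1 j) (h.1 j),
      Lp.coeFn_smul (l : 𝕜) (c.1 j)] with x h1 h2 h3
    rw [h1, Pi.neg_apply, h2, Pi.sub_apply, h3, Pi.smul_apply, neg_sub,
      RCLike.real_smul_eq_coe_smul (K := 𝕜)]
  · have := hasWeakDerivOn_of_exp_smul (c.2.1 j) (h.2.1 j) (hcV j)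
      (hasWeakDerivOn_integral_Iio _ (hVi j)) (by
        filter_upwards [ae_restrict_mem measurableSet_Ioi] with x hx
        rw [hgV]
        simp only
        rw [stateV_of_pos _ hx]
        rfl)
    refine this.congr (ae_eq_refl _) ?_
    change _ =ᵐ[muU] (-((l : 𝕜) • c.2.1 j - h.2.1 j) : Lp 𝕜 p muU)
    filter_upwards [Lp.coeFn_neg ((l : 𝕜) • c.2.1 j - h.2.1 j),
      Lp.coeFn_sub ((l : 𝕜) • c.2.1 j) (h.2.1 j),
      Lp.coeFn_smul (l : 𝕜) (c.2.1 j)] with x h1 h2 h3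
    rw [h1, Pi.neg_apply, h2, Pi.sub_apply, h3, Pi.smul_apply, neg_sub,
      RCLike.real_smul_eq_coe_smul (K := 𝕜)]
  · have := hasWeakDerivOn_of_exp_smul (c.2.2 j) (-h.2.2 j) (hcW j)
      (hasWeakDerivOn_integral_Ioi _ (hgWi j)) (by
        filter_upwards [ae_restrict_mem measurableSet_Ioi, Lp.coeFn_neg (h.2.2 j)] with x hx hn
        rw [hgW]
        simp only
        rw [indicator_of_mem hx, hn, Pi.neg_apply, smul_neg]
        rfl)
    refine this.congr (ae_eq_refl _) ?_
    change _ =ᵐ[muU] ((l : 𝕜) • c.2.2 j - h.2.2 j : Lp 𝕜 p muU)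
    filter_upwards [Lp.coeFn_neg (h.2.2 j), Lp.coeFn_sub ((l : 𝕜) • c.2.2 j) (h.2.2 j),
      Lp.coeFn_smul (l : 𝕜) (c.2.2 j)] with x h1 h2 h3
    rw [h1, Pi.neg_apply, h2, Pi.sub_apply, h3, Pi.smul_apply, neg_smul, sub_neg_eq_add,
      RCLike.real_smul_eq_coe_smul (K := 𝕜), neg_add_eq_sub]
  · have hB : B = Matrix.fromBlocks B.toBlocks₁₁ B.toBlocks₁₂ B.toBlocks₂₁ B.toBlocks₂₂ :=
      (Matrix.fromBlocks_toBlocks B).symm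
    rw [hB, Matrix.fromBlocks_mulVec]
    simp only [Sum.elim_comp_inl, Sum.elim_comp_inr, mul_zero, Real.exp_zero, one_smul, mul_one]
    simp only [hPU _ 0 zero_le_one, hPU _ 1 le_rfl, hPW _ 0 le_rfl]
    rw [← integral_Iio_zero_recursion (fun s hs => stateU_of_neg h hs) hUi hWi,
      ← integral_Iio_zero_recursion (fun s hs => stateV_of_nonpos h hs.le) hUi hWi]

end Domain

/-! ### The transport operator has no large real eigenvalues -/

section Injectivity

variable {𝕜 : Type*} [RCLike 𝕜] {p : ℝ≥0∞}

lemma hasWeakDerivOn_of_coe_smul {s : Set ℝ} {f : Lp 𝕜 p (volume.restrict s)} {l : ℝ}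
    (h : HasWeakDerivOn s f ((l : 𝕜) • f : Lp 𝕜 p (volume.restrict s))) :
    HasWeakDerivOn s f fun x => -((-l) • f x) := by
  refine h.congr (ae_eq_refl _) ((Lp.coeFn_smul (l : 𝕜) f).mono fun x hx => ?_)
  simp only [hx, Pi.smul_apply, neg_smul, neg_neg]
  rw [RCLike.real_smul_eq_coe_smul (K := 𝕜)]

lemma hasWeakDerivOn_of_neg_coe_smul {s : Set ℝ} {f : Lp 𝕜 p (volume.restrict s)} {l : ℝ}
    (h : HasWeakDerivOn s f (-((l : 𝕜) • f) : Lp 𝕜 p (volume.restrict s))) :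
    HasWeakDerivOn s f fun x => -(l • f x) := by
  rw [← neg_smul, ← RCLike.ofReal_neg] at h
  simpa using hasWeakDerivOn_of_coe_smul h

variable [Fact (1 ≤ p)]

lemma exists_ae_eq_exp_smul {s : Set ℝ} (hs : IsOpen s) (hconn : s.OrdConnected)
    (hne : s.Nonempty) (l : ℝ) (f : Lp 𝕜 p (volume.restrict s))
    (h : HasWeakDerivOn s f fun x => -(l • f x)) :
    ∃ c : 𝕜, f =ᵐ[volume.restrict s] fun x => Real.exp (-l * x) • c := by
  have hf : LocallyIntegrable f (volume.restrict s) := (Lp.memLp f).locallyIntegrable Fact.out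
  have h0 : LocallyIntegrable (fun _ => (0 : 𝕜)) (volume.restrict s) := locallyIntegrable_const 0
  have h1 := (hasWeakDerivOn_exp_smul_iff hf h0 l).2 (by simpa using h)
  obtain ⟨c, hc⟩ := HasWeakDerivOn.exists_ae_eq_const hs hconn hne
    (hf.continuous_smul (g := fun x : ℝ => Real.exp (l * x)) (by fun_prop)) (by simpa using h1)
  refine ⟨c, hc.mono fun x hx => ?_⟩
  simp only at hx ⊢
  rw [← hx, smul_smul, ← Real.exp_add]
  simp

/-- Nonzero multiples of increasing exponentials are not in `L^p(0, ∞)`. -/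
lemma eq_zero_of_ae_eq_exp_smul (hp : p ≠ ⊤) {l : ℝ} (hl : 0 ≤ l) (f : Lp 𝕜 p muU) {c : 𝕜}
    (h : f =ᵐ[muU] fun x => Real.exp (l * x) • c) : c = 0 := by
  have h1 : MemLp (fun x => Real.exp (l * x) • c) p muU := (memLp_congr_ae h).1 (Lp.memLp f)
  have h2 : MemLp (fun _ : ℝ => c) p muU := by
    refine h1.mono aestronglyMeasurable_const ?_
    filter_upwards [ae_restrict_mem measurableSet_Ioi] with x hx
    rw [norm_smul, Real.norm_of_nonneg (Real.exp_pos _).le]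
    refine le_mul_of_one_le_left (norm_nonneg _) (Real.one_le_exp (mul_nonneg hl (le_of_lt hx)))
  have hp0 : p ≠ 0 := (one_pos.trans_le (Fact.out : 1 ≤ p)).ne'
  simpa [memLp_const_iff hp0 hp] using h2

variable {m q r : ℕ} {B : Matrix (Fin m ⊕ Fin q) (Fin m ⊕ Fin r) 𝕜}

/-- A real number `l ≥ 0` is not an eigenvalue of the transport operator if `e^l` is not an
eigenvalue of the block `B¹¹`: eigenfunctions are `e^{-lx} c` on the bounded edges, where
`c = e^{-l} B¹¹ c`. -/
lemma IsTransportPair.eq_zero (hp : p ≠ ⊤) {l : ℝ} (hl : 0 ≤ l)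
    (hB : ∀ c : Fin m → 𝕜, c = B.toBlocks₁₁ *ᵥ (Real.exp (-l) • c) → c = 0)
    {f : StateSpace 𝕜 p m q r} (h : IsTransportPair B f ((l : 𝕜) • f)) : f = 0 := by
  obtain ⟨hu, hv, hw, u0, u1, v0, w0, hu0, hu1, hv0, hw0, hbd⟩ := h
  choose c hc using fun j => exists_ae_eq_exp_smul isOpen_Ioo ordConnected_Ioo
    (nonempty_Ioo.2 one_pos) l (f.1 j) (hasWeakDerivOn_of_neg_coe_smul (hu j))
  choose d hd using fun j => exists_ae_eq_exp_smul isOpen_Ioi ordConnected_Ioi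
    nonempty_Ioi l (f.2.1 j) (hasWeakDerivOn_of_neg_coe_smul (hv j))
  choose e he using fun j => exists_ae_eq_exp_smul isOpen_Ioi ordConnected_Ioi
    nonempty_Ioi (-l) (f.2.2 j) (hasWeakDerivOn_of_coe_smul (hw j))
  have hcont : ∀ (a : ℝ) (z : 𝕜) (s : Set ℝ), ContinuousOn (fun x => Real.exp (a * x) • z) s :=
    fun a z s => Continuous.continuousOn (by fun_prop)
  have he0 : ∀ j, e j = 0 := fun j =>
    eq_zero_of_ae_eq_exp_smul hp hl (f.2.2 j) (by simpa using he j)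
  have h0 : (0 : ℝ) ∈ closure (Ioo (0 : ℝ) 1) := by simp [closure_Ioo]
  have h1 : (1 : ℝ) ∈ closure (Ioo (0 : ℝ) 1) := by simp [closure_Ioo]
  have h0' : (0 : ℝ) ∈ closure (Ioi (0 : ℝ)) := by simp
  have eu0 : u0 = c := funext fun j => by
    simpa using (hu0 j).eq_of_ae_eq isOpen_Ioo h0 (hcont _ _ _) (hc j)
  have eu1 : u1 = Real.exp (-l) • c := funext fun j => by
    simpa using (hu1 j).eq_of_ae_eq isOpen_Ioo h1 (hcont _ _ _) (hc j)
  have ev0 : v0 = d := funext fun j => by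
    simpa using (hv0 j).eq_of_ae_eq isOpen_Ioi h0' (hcont _ _ _) (hd j)
  have ew0 : w0 = 0 := funext fun j => by
    simpa [he0] using (hw0 j).eq_of_ae_eq isOpen_Ioi h0' (hcont _ _ _) (he j)
  rw [← Matrix.fromBlocks_toBlocks B, Matrix.fromBlocks_mulVec] at hbd
  simp only [Sum.elim_comp_inl, Sum.elim_comp_inr] at hbd
  rw [Sum.elim_eq_iff, eu0, eu1, ev0, ew0, Matrix.mulVec_zero, Matrix.mulVec_zero, add_zero,
    add_zero] at hbd
  have hc0 : c = 0 := hB c hbd.1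
  have hd0 : d = 0 := by rw [hbd.2, hc0, smul_zero, Matrix.mulVec_zero]
  refine Prod.ext (funext fun j => ?_) (Prod.ext (funext fun j => ?_) (funext fun j => ?_))
  · refine (Lp.eq_zero_iff_ae_eq_zero).2 ((hc j).trans ?_)
    simp [hc0, Pi.zero_def]
  · refine (Lp.eq_zero_iff_ae_eq_zero).2 ((hd j).trans ?_)
    simp [hd0, Pi.zero_def]
  · refine (Lp.eq_zero_iff_ae_eq_zero).2 ((he j).trans ?_)
    simp [he0, Pi.zero_def]

lemma IsTransportPair.sub {f g f' g' : StateSpace 𝕜 p m q r} (h : IsTransportPair B f g)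
    (h' : IsTransportPair B f' g') : IsTransportPair B (f - f') (g - g') :=
  (transportGraph B).sub_mem (x := (f, g)) (y := (f', g')) h h'

/-- For large real `l` the number `e^l` exceeds the norm of `B¹¹`. -/
lemma exists_forall_eq_zero_of_eq_mulVec (M : Matrix (Fin m) (Fin m) 𝕜) (b : ℝ) :
    ∃ l : ℝ, b < l ∧ 0 ≤ l ∧ ∀ c : Fin m → 𝕜, c = M *ᵥ (Real.exp (-l) • c) → c = 0 := by
  set N := (Matrix.mulVecLin M).toContinuousLinearMap with hN
  have hle : ∀ x, ‖M *ᵥ x‖ ≤ ‖N‖ * ‖x‖ := fun x => N.le_opNorm x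
  have hl0 : 0 ≤ max b ‖N‖ + 1 := by
    have := (norm_nonneg N).trans (le_max_right b ‖N‖)
    linarith
  refine ⟨max b ‖N‖ + 1, by linarith [le_max_left b ‖N‖], hl0, fun c hc => ?_⟩
  set l := max b ‖N‖ + 1
  by_contra hne
  have hpos : 0 < ‖c‖ := norm_pos_iff.2 hne
  have h1 : ‖c‖ ≤ ‖N‖ * (Real.exp (-l) * ‖c‖) := by
    calc ‖c‖ = ‖M *ᵥ (Real.exp (-l) • c)‖ := by rw [← hc]
      _ ≤ ‖N‖ * ‖Real.exp (-l) • c‖ := hle _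
      _ = _ := by rw [norm_smul, Real.norm_of_nonneg (Real.exp_pos _).le]
  have h2 : ‖N‖ < Real.exp l := by
    have := Real.add_one_le_exp l
    linarith [le_max_right b ‖N‖]
  have h3 : ‖N‖ * Real.exp (-l) < 1 := by
    rw [Real.exp_neg, ← div_eq_mul_inv]
    exact (div_lt_one (Real.exp_pos l)).2 h2
  have h4 : ‖N‖ * (Real.exp (-l) * ‖c‖) = (‖N‖ * Real.exp (-l)) * ‖c‖ := by ring
  rw [h4] at h1
  exact absurd h1 (not_le.2 (mul_lt_of_lt_one_left hpos h3))

end Injectivity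

/-! ### The generator -/

section Generator

variable {𝕜 : Type*} [RCLike 𝕜] {p : ℝ≥0∞} [Fact (1 ≤ p)] {m q r : ℕ}
  {B : Matrix (Fin m ⊕ Fin q) (Fin m ⊕ Fin r) 𝕜}
  {T : ℝ≥0 → StateSpace 𝕜 p m q r →L[𝕜] StateSpace 𝕜 p m q r}

/-- The generator of the solution semigroup is the transport operator. With a large real `l`, every
element of the domain of the generator is a Laplace transform at `l`, so that it is in the domain of
the transport operator; conversely, `l` minus the transport operator is injective, so that it is not
a proper extension of `l` minus the generator, which is surjective. -/
theorem IsExplicitFamily.isGenerator (hp : p ≠ ⊤) (hT : IsExplicitFamily B T) :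
    IsGenerator T (transportOperator p B) := by
  obtain ⟨hC0, M, b, -, hM⟩ := hT.isC0Semigroup hp
  obtain ⟨l, hbl, hl0, hl⟩ := exists_forall_eq_zero_of_eq_mulVec B.toBlocks₁₁ b
  obtain ⟨R, hR⟩ := hC0.exists_laplace hM (lam := (l : 𝕜)) (by rwa [RCLike.ofReal_re])
  have hpair : ∀ h, IsTransportPair B (R h) ((l : 𝕜) • R h - h) := fun h =>
    hT.isTransportPair_laplace (hR h)
  intro f g
  rw [mem_graph_transportOperator]
  constructor
  · intro hfg
    have h1 := hfg.sub (hpair ((l : 𝕜) • f - g))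
    have h2 : g - ((l : 𝕜) • R ((l : 𝕜) • f - g) - ((l : 𝕜) • f - g)) =
        (l : 𝕜) • (f - R ((l : 𝕜) • f - g)) := by
      rw [smul_sub]
      abel
    rw [h2] at h1
    have h3 : f = R ((l : 𝕜) • f - g) := sub_eq_zero.1 (h1.eq_zero hp hl0 hl)
    have h4 := hC0.isRightDeriv_laplace (hR ((l : 𝕜) • f - g))
    rw [← h3, sub_sub_cancel] at h4
    exact h4
  · intro hfg
    have h1 := hpair ((l : 𝕜) • f - g)
    rwa [hC0.laplace_sub_eq hR hfg, sub_sub_cancel] at h1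

end Generator

end NetworkTransport

theorem mainTheorem1 {𝕜 : Type*} [RCLike 𝕜] (m q r : ℕ) (p : ℝ≥0∞) [Fact (1 ≤ p)] (hp : p ≠ ⊤)
    (B : Matrix (Fin m ⊕ Fin q) (Fin m ⊕ Fin r) 𝕜) :
    -- the explicit formula defines exactly one family of bounded operators on `X_p`
    ∃ T : ℝ≥0 → NetworkTransport.StateSpace 𝕜 p m q r →L[𝕜] NetworkTransport.StateSpace 𝕜 p m q r,
      NetworkTransport.IsExplicitFamily B T ∧
      (∀ S, NetworkTransport.IsExplicitFamily B S → S = T) ∧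
      -- the Laplace transform of `T` is the resolvent of `A_p`, both as an integral in `X_p` ...
      (∃ a : ℝ, ∀ lam : 𝕜, a < RCLike.re lam →
        ∃ R : NetworkTransport.StateSpace 𝕜 p m q r →L[𝕜] NetworkTransport.StateSpace 𝕜 p m q r,
          NetworkTransport.IsResolvent (NetworkTransport.transportOperator p B) lam R ∧
          ∀ f : NetworkTransport.StateSpace 𝕜 p m q r,
            NetworkTransport.HasLaplace lam (fun t : ℝ => T t.toNNReal f) (R f) ∧
            -- ... and pointwise in the space variable
            (∀ j, ∀ᵐ x ∂NetworkTransport.muB, NetworkTransport.HasLaplace lam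
              (fun t : ℝ => NetworkTransport.formulaU B f t x j) ((R f).1 j x)) ∧
            (∀ j, ∀ᵐ x ∂NetworkTransport.muU, NetworkTransport.HasLaplace lam
              (fun t : ℝ => NetworkTransport.formulaV B f t x j) ((R f).2.1 j x)) ∧
            (∀ j, ∀ᵐ x ∂NetworkTransport.muU, NetworkTransport.HasLaplace lam
              (fun t : ℝ => NetworkTransport.formulaW f t x j) ((R f).2.2 j x))) ∧
      -- `T` is the strongly continuous semigroup generated by `A_p`
      NetworkTransport.IsC0Semigroup T ∧
      NetworkTransport.IsGenerator T (NetworkTransport.transportOperator p B) := by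
  obtain ⟨T, hT⟩ := NetworkTransport.exists_isExplicitFamily p B
  obtain ⟨hC0, M, b, -, hM⟩ := hT.isC0Semigroup hp
  have hgen := hT.isGenerator hp
  refine ⟨T, hT, fun S hS => hS.unique hT, ⟨b, fun lam hlam => ?_⟩, hC0, hgen⟩
  obtain ⟨R, hR⟩ := hC0.exists_laplace hM hlam
  exact ⟨R, hC0.isResolvent hgen hR, fun f => ⟨hR f, hT.ae_hasLaplace_formula (hR f)⟩⟩
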